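/- **Setting.** Fix integers $d,m\ge 0$. Let $\mathscr D^m(\mathbb R^d)$ be the space of compactly supported smooth $m$-forms, $\|\cdot\|_\infty$ the supremum of the pointwise comass norm, and $\mathscr D_m(\mathbb R^d)$ the $m$-currents (topological dual of $\mathscr D^m(\mathbb R^d)$). For a current $T$ let $\mathbf M(T)=\sup\{T(\psi):\|\psi\|_\infty\le 1\}$, $\mathbf N(T)=\mathbf M(T)+\mathbf M(\partial T)$ (with $\partial T=0$ if $m=0$) and $\mathbf F(T)=\sup\{T(\psi):\max(\|\psi\|_\infty,\|d\psi\|_\infty)\le 1\}$. A current is normal if it has compact support and $\mathbf N(T)<\infty$; $\mathbf N_m(\mathbb R^d)$ is the space of normal $m$-currents, and $\mathbf N_m(K)$ consists of those supported in $K$. An $m$-charge over $\mathbb R^d$ is a linear map $\omega:\mathbf N_m(\mathbb R^d)\to\mathbb R$ such that, for every compact $K$, $\omega(T_n)\to 0$ for every $\mathbf N$-bounded sequence $(T_n)$ in $\mathbf N_m(K)$ with $\mathbf F(T_n)\to 0$. Put $$\|\omega\|_{CH^m(K)}=\sup\{\omega(T):T\in\mathbf N_m(K),\ \mathbf N(T)\le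 1\},$$ $$\|\omega\|_{CH^{m,\alpha}(K)}=\inf\{c\ge 0:|\omega(T)|\le c\,\mathbf N(T)^{1-\alpha}\mathbf F(T)^{\alpha}\ \text{for all }T\in\mathbf N_m(K)\}\in[0,\infty].$$ For $0<\alpha\le 1$, the charge $\omega$ is $\alpha$-fractional, $\omega\in CH^{m,\alpha}(\mathbb R^d)$, if $\|\omega\|_{CH^{m,\alpha}(K)}<\infty$ for all compact $K$. A sequence $(\omega_n)$ converges weakly-* to $\omega$ in $CH^{m,\alpha}(\mathbb R^d)$ if all its terms and $\omega$ are $\alpha$-fractional and, for every compact $K$, $\sup_n\|\omega_n\|_{CH^{m,\alpha}(K)}<\infty$ and $\|\omega_n-\omega\|_{CH^m(K)}\to 0$. For $\phi\in C_c^\infty(\mathbb R^d)$ let $\check\phi(x)=\phi(-x)$, $(T*\phi)(\psi)=T(\check\phi*\psi)$ for $T \in \mathbf N_m(\mathbb R^d)$, and $(\omega*\phi)(T)=\omega(T*\check\phi)$. Fix a smooth, nonnegative, even $\Phi:\mathbb R^d\to\mathbb R$ supported in the closed unit ball with $\int\Phi=1$, and let $\Phi_\varepsilon(x)=\varepsilon^{-d}\Phi(\varepsilon^{-1}x)$.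 For compact $K$ let $K_\varepsilon=\{x:\operatorname{dist}(x,K)\le\varepsilon\}$. **Proposition.** There is a constant $C\ge 0$, depending only on $d,m,\Phi$, such that for every $\alpha\in(0,1]$ and every $\omega\in CH^{m,\alpha}(\mathbb R^d)$ the following holds. 1. For every $\varepsilon\in(0,1]$, $\omega*\Phi_\varepsilon$ is a smooth form: there is a smooth $m$-form $\eta$ on $\mathbb R^d$ with $(\omega*\Phi_\varepsilon)(T)=T(\eta)$ for all $T\in\mathbf N_m(\mathbb R^d)$ (as $T$ has compact support, $T(\eta)$ means $T(\psi)$ for any $\psi\in\mathscr D^m(\mathbb R^d)$ equal to $\eta$ near the support of $T$). 2. For every compact $K\subset\mathbb R^d$ and $\varepsilon\in(0,1]$, (A) $\|\omega*\Phi_\varepsilon\|_{CH^{m,\alpha}(K)}\le\|\omega\|_{CH^{m,\alpha}(K_\varepsilon)}$; (B) $\|\omega*\Phi_\varepsilon\|_{CH^{m,1}(K)}\le C\varepsilon^{\alpha-1}\|\omega\|_{CH^{m,\alpha}(K_\varepsilon)}$; (C) $\|\omega-\omega*\Phi_\varepsilon\|_{CH^m(K)}\le C\varepsilon^{\alpha}\|\omega\|_{CH^{m,\alpha}(K_\varepsilon)}$.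 3. $\omega*\Phi_\varepsilon\to\omega$ weakly-* in $CH^{m,\alpha}(\mathbb R^d)$ as $\varepsilon\to 0$: for every sequence $(\varepsilon_n)$ in $(0,1]$ tending to $0$, $(\omega*\Phi_{\varepsilon_n})$ converges weakly-* to $\omega$. -/

import Mathlib

open Set Filter Topology MeasureTheory Distributions Convolution Pointwise
open scoped ENNReal NNReal

noncomputable section

namespace FracCharge

/-- Euclidean space `ℝ^d`. -/
abbrev Eu (d : ℕ) : Type := EuclideanSpace ℝ (Fin d)

/-- `m`-covectors of `ℝ^d`, as alternating `m`-linear forms. The operator norm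
`sup |η (v₁, …, v_m)|` over `|v_i| ≤ 1` is the comass norm: by Hadamard's inequality
`|v₁ ∧ ⋯ ∧ v_m| ≤ |v₁| ⋯ |v_m|`, and every simple unit `m`-vector is
`v₁ ∧ ⋯ ∧ v_m` with `v` orthonormal. -/
abbrev Covector (d m : ℕ) : Type := Eu d [⋀^Fin m]→L[ℝ] ℝ

/-- `𝓓^m(ℝ^d)`: compactly supported smooth `m`-forms, with the usual LF topology. -/
abbrev TestForm (d m : ℕ) : Type := 𝓓((⊤ : TopologicalSpace.Opens (Eu d)), Covector d m)

/-- `C_c^∞(ℝ^d)`. -/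
abbrev TestFun (d : ℕ) : Type := 𝓓((⊤ : TopologicalSpace.Opens (Eu d)), ℝ)

/-- `𝓓_m(ℝ^d)`: the `m`-currents, i.e. the topological dual of `𝓓^m(ℝ^d)`. -/
abbrev Current (d m : ℕ) : Type := TestForm d m →L[ℝ] ℝ

variable {d m : ℕ}

/-- The exterior derivative on compactly supported smooth forms. -/
def extD : TestForm d m →L[ℝ] TestForm d (m + 1) :=
  (TestFunction.postcompCLM
    (ContinuousAlternatingMap.alternatizeUncurryFinCLM ℝ (Eu d) ℝ)).comp
    (TestFunction.fderivCLM ℝ ⊤ ⊤)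

theorem extD_apply (ψ : TestForm d m) (x : Eu d) : extD ψ x = extDeriv ψ x := by
  simp [extD, extDeriv]

/-- The boundary `∂T (ψ) = T (dψ)` of a current of positive dimension. -/
def boundary (T : Current d (m + 1)) : Current d m := T.comp extD

/-- The support of a current. -/
def spt (T : Current d m) : Set (Eu d) := Distribution.dsupport (fun ψ : TestForm d m => T ψ)

/-- The mass `M(T) = sup {T(ψ) : ‖ψ‖_∞ ≤ 1}`. -/
def mass (T : Current d m) : ℝ≥0∞ :=
  ⨆ (ψ : TestForm d m) (_ : ∀ x, ‖ψ x‖ ≤ 1), ENNReal.ofReal (T ψ)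

/-- The mass `M(∂T)` of the boundary; the boundary of a `0`-current is zero. -/
def bdMass : {m : ℕ} → Current d m → ℝ≥0∞
  | 0, _ => 0
  | _ + 1, T => mass (boundary T)

/-- The normal mass `N(T) = M(T) + M(∂T)`. -/
def normalMass (T : Current d m) : ℝ≥0∞ := mass T + bdMass T

/-- The flat norm `F(T) = sup {T(ψ) : max (‖ψ‖_∞, ‖dψ‖_∞) ≤ 1}`. -/
def flatNorm (T : Current d m) : ℝ≥0∞ :=
  ⨆ (ψ : TestForm d m) (_ : ∀ x, ‖ψ x‖ ≤ 1 ∧ ‖extDeriv ψ x‖ ≤ 1), ENNReal.ofReal (T ψ)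

theorem mass_add_le (S T : Current d m) : mass (S + T) ≤ mass S + mass T := by
  refine iSup₂_le fun ψ hψ => ?_
  calc ENNReal.ofReal ((S + T) ψ) ≤ ENNReal.ofReal (S ψ) + ENNReal.ofReal (T ψ) := by
        simpa using ENNReal.ofReal_add_le
    _ ≤ _ := add_le_add (le_iSup₂_of_le ψ hψ le_rfl) (le_iSup₂_of_le ψ hψ le_rfl)

theorem mass_smul_le (c : ℝ) (T : Current d m) :
    mass (c • T) ≤ ENNReal.ofReal |c| * mass T := by
  refine iSup₂_le fun ψ hψ => ?_
  rcases le_total 0 c with hc | hc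
  · rw [abs_of_nonneg hc]
    calc ENNReal.ofReal ((c • T) ψ) = ENNReal.ofReal c * ENNReal.ofReal (T ψ) := by
          simp [ENNReal.ofReal_mul hc]
      _ ≤ _ := by gcongr; exact le_iSup₂_of_le ψ hψ le_rfl
  · rw [abs_of_nonpos hc]
    calc ENNReal.ofReal ((c • T) ψ) = ENNReal.ofReal (-c) * ENNReal.ofReal (T (-ψ)) := by
          rw [← ENNReal.ofReal_mul (by linarith)]; simp
      _ ≤ _ := by gcongr; exact le_iSup₂_of_le (-ψ) (by simpa using hψ) le_rfl

theorem bdMass_add_le : ∀ {m : ℕ} (S T : Current d m), bdMass (S + T) ≤ bdMass S + bdMass T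
  | 0, _, _ => by simp [bdMass]
  | _ + 1, S, T => by
      have := mass_add_le (boundary S) (boundary T)
      simpa [bdMass, boundary] using this

theorem bdMass_smul_le : ∀ {m : ℕ} (c : ℝ) (T : Current d m),
    bdMass (c • T) ≤ ENNReal.ofReal |c| * bdMass T
  | 0, _, _ => by simp [bdMass]
  | _ + 1, c, T => by
      have := mass_smul_le c (boundary T)
      simpa [bdMass, boundary] using this

/-- If `T ψ ≤ C` whenever `‖ψ‖_∞ ≤ 1`, then `M(T) ≤ C`. -/
theorem mass_le_of_bound (T : Current d m) (C : ℝ)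
    (h : ∀ ψ : TestForm d m, (∀ x, ‖ψ x‖ ≤ 1) → T ψ ≤ C) : mass T ≤ ENNReal.ofReal C :=
  iSup₂_le fun ψ hψ => ENNReal.ofReal_le_ofReal (h ψ hψ)

theorem abs_le_of_mass (T : Current d m) (hT : mass T ≠ ⊤) (ψ : TestForm d m) (R : ℝ)
    (hR : ∀ x, ‖ψ x‖ ≤ R) : |T ψ| ≤ (mass T).toReal * R := by
  have key : ∀ χ : TestForm d m, (∀ x, ‖χ x‖ ≤ R) → T χ ≤ (mass T).toReal * R := by
    intro χ hχ
    have hR0 : 0 ≤ R := (norm_nonneg _).trans (hχ 0)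
    rcases hR0.eq_or_lt with h0 | h0
    · have : χ = 0 := by
        ext1 x
        have := hχ x
        rw [← h0] at this
        simpa using this
      simp [this, ← h0]
    · have h1 : ENNReal.ofReal (T (R⁻¹ • χ)) ≤ mass T := by
        refine le_iSup₂_of_le (R⁻¹ • χ) (fun x => ?_) le_rfl
        have : ‖(R⁻¹ • χ) x‖ = R⁻¹ * ‖χ x‖ := by
          simp [norm_smul, abs_of_pos h0]
        rw [this, inv_mul_le_iff₀ h0]
        simpa using hχ x
      have h2 := (ENNReal.ofReal_le_iff_le_toReal hT).1 h1
      rw [map_smul, smul_eq_mul, inv_mul_le_iff₀ h0] at h2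
      linarith
  refine abs_le.2 ⟨?_, key ψ hR⟩
  have := key (-ψ) (by simpa using hR)
  rw [map_neg] at this
  linarith

theorem spt_add_subset (S T : Current d m) : spt (S + T) ⊆ spt S ∪ spt T := by
  intro x hx
  by_contra hcon
  rw [mem_union, not_or] at hcon
  obtain ⟨⟨s, hs, hso, hxs⟩, ⟨t, ht, hto, hxt⟩⟩ :=
    And.intro ((Distribution.notMem_dsupport_iff x).1 hcon.1)
      ((Distribution.notMem_dsupport_iff x).1 hcon.2)
  refine (Distribution.notMem_dsupport_iff x).2
    ⟨s ∩ t, fun ψ hψ => ?_, hso.inter hto, hxs, hxt⟩ hx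
  have h1 := hs ψ (hψ.trans inter_subset_left)
  have h2 := ht ψ (hψ.trans inter_subset_right)
  simp only [add_apply, h1, h2, add_zero]

theorem spt_smul_subset (c : ℝ) (T : Current d m) : spt (c • T) ⊆ spt T := by
  refine Distribution.dsupport_subset_dsupport fun s _ hs ψ hψ => ?_
  have := hs ψ hψ
  simp only [smul_apply, this, smul_zero]

theorem spt_zero : spt (0 : Current d m) = ∅ := by
  refine eq_empty_of_forall_notMem fun x => ?_
  exact (Distribution.notMem_dsupport_iff x).2
    ⟨univ, fun ψ _ => by simp, isOpen_univ, mem_univ x⟩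

/-- `N_m(ℝ^d)`: the normal currents, i.e. the currents with compact support and finite
normal mass. -/
def NormalCurrents (d m : ℕ) : Submodule ℝ (Current d m) where
  carrier := {T | IsCompact (spt T) ∧ normalMass T ≠ ⊤}
  zero_mem' := by
    refine ⟨by rw [spt_zero]; exact isCompact_empty, ?_⟩
    have h1 := mass_smul_le (d := d) (m := m) 0 0
    have h2 := bdMass_smul_le (d := d) (m := m) 0 0
    simp only [smul_zero, abs_zero, ENNReal.ofReal_zero, zero_mul, nonpos_iff_eq_zero] at h1 h2
    simp [normalMass, h1, h2]
  add_mem' := by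
    rintro S T ⟨hS, hS'⟩ ⟨hT, hT'⟩
    refine ⟨(hS.union hT).of_isClosed_subset Distribution.isClosed_dsupport
      (spt_add_subset S T), ?_⟩
    simp only [normalMass, ne_eq, ENNReal.add_eq_top, not_or] at hS' hT' ⊢
    exact ⟨ne_top_of_le_ne_top (ENNReal.add_ne_top.2 ⟨hS'.1, hT'.1⟩) (mass_add_le S T),
      ne_top_of_le_ne_top (ENNReal.add_ne_top.2 ⟨hS'.2, hT'.2⟩) (bdMass_add_le S T)⟩
  smul_mem' := by
    rintro c T ⟨hT, hT'⟩
    refine ⟨hT.of_isClosed_subset Distribution.isClosed_dsupport (spt_smul_subset c T), ?_⟩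
    simp only [normalMass, ne_eq, ENNReal.add_eq_top, not_or] at hT' ⊢
    exact ⟨ne_top_of_le_ne_top (ENNReal.mul_ne_top ENNReal.ofReal_ne_top hT'.1)
        (mass_smul_le c T),
      ne_top_of_le_ne_top (ENNReal.mul_ne_top ENNReal.ofReal_ne_top hT'.2)
        (bdMass_smul_le c T)⟩

/-! ### Convolution of normal currents -/

/-- The reflection `φ̌ (x) = φ (-x)`. -/
def reflect (φ : TestFun d) : TestFun d where
  toFun x := φ (-x)
  contDiff' := φ.contDiff.comp contDiff_neg
  hasCompactSupport' := φ.hasCompactSupport.comp_homeomorph (Homeomorph.neg (Eu d))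
  tsupport_subset' := by simp

theorem locallyIntegrable (φ : TestFun d) : LocallyIntegrable φ (volume : Measure (Eu d)) :=
  φ.continuous.locallyIntegrable

theorem integrable_testFun (φ : TestFun d) : Integrable φ (volume : Measure (Eu d)) :=
  φ.continuous.integrable_of_hasCompactSupport φ.hasCompactSupport

/-- The convolution `(φ * ψ)(x) = ∫ φ(y) ψ(x - y) dy` of a smooth function and a smooth form,
both with compact support. -/
def convForm (φ : TestFun d) : TestForm d m →ₗ[ℝ] TestForm d m where
  toFun ψ :=
    { toFun := (φ : Eu d → ℝ) ⋆[ContinuousLinearMap.lsmul ℝ ℝ, volume] (ψ : Eu d → Covector d m)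
      contDiff' := ψ.hasCompactSupport.contDiff_convolution_right _ (locallyIntegrable φ)
        ψ.contDiff
      hasCompactSupport' := φ.hasCompactSupport.convolution _ ψ.hasCompactSupport
      tsupport_subset' := by simp }
  map_add' ψ χ := by
    ext1 x
    have h1 := ψ.hasCompactSupport.convolutionExists_right (ContinuousLinearMap.lsmul ℝ ℝ)
      (locallyIntegrable φ) ψ.continuous
    have h2 := χ.hasCompactSupport.convolutionExists_right (ContinuousLinearMap.lsmul ℝ ℝ)
      (locallyIntegrable φ) χ.continuous
    exact congrFun (h1.distrib_add h2) x
  map_smul' c ψ := by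
    ext1 x
    exact congrFun (convolution_smul (𝕜 := ℝ) (y := c)) x

theorem convForm_apply (φ : TestFun d) (ψ : TestForm d m) (x : Eu d) :
    convForm φ ψ x = ∫ y, φ y • ψ (x - y) := rfl

theorem norm_convForm_le (φ : TestFun d) (ψ : TestForm d m) (R : ℝ) (hR : ∀ x, ‖ψ x‖ ≤ R)
    (x : Eu d) : ‖convForm φ ψ x‖ ≤ (∫ y, ‖φ y‖) * R := by
  rw [convForm_apply, ← integral_mul_const]
  refine norm_integral_le_of_norm_le ((integrable_testFun φ).norm.mul_const R)
    (Eventually.of_forall fun y => ?_)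
  rw [norm_smul]
  gcongr
  exact hR _

/-- Convolution commutes with a linear first-order operator of constant coefficients. -/
theorem fderiv_conv_comp {G H : Type*} [NormedAddCommGroup G] [NormedSpace ℝ G] [CompleteSpace G]
    [NormedAddCommGroup H] [NormedSpace ℝ H] [CompleteSpace H] (A : (Eu d →L[ℝ] G) →L[ℝ] H)
    (φ : Eu d → ℝ) (hφ : LocallyIntegrable φ (volume : Measure (Eu d))) (ψ : Eu d → G)
    (hψ : ContDiff ℝ 1 ψ) (hc : HasCompactSupport ψ) (x : Eu d) :
    A (fderiv ℝ (φ ⋆[ContinuousLinearMap.lsmul ℝ ℝ, volume] ψ) x) =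
      ∫ y, φ y • A (fderiv ℝ ψ (x - y)) := by
  have hd := hc.hasFDerivAt_convolution_right
    (ContinuousLinearMap.lsmul ℝ ℝ) (μ := volume) hφ hψ x
  have hd' : fderiv ℝ (φ ⋆[ContinuousLinearMap.lsmul ℝ ℝ, volume] ψ) x =
    ∫ y, φ y • fderiv ℝ ψ (x - y) := hd.fderiv
  have hi : Integrable (fun y => φ y • fderiv ℝ ψ (x - y)) volume :=
    (hc.fderiv ℝ).convolutionExists_right (ContinuousLinearMap.lsmul ℝ ℝ)
      hφ (hψ.continuous_fderiv (by simp)) x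
  rw [hd', ← ContinuousLinearMap.integral_comp_comm _ hi]
  simp only [map_smul]

theorem extD_convForm (φ : TestFun d) (ψ : TestForm d m) :
    extD (convForm φ ψ) = convForm φ (extD ψ) := by
  ext1 x
  rw [extD_apply, convForm_apply]
  simp only [extD_apply]
  exact fderiv_conv_comp (ContinuousAlternatingMap.alternatizeUncurryFinCLM ℝ (Eu d) ℝ)
    φ (locallyIntegrable φ) ψ (ψ.contDiff.of_le (by exact_mod_cast le_top))
    ψ.hasCompactSupport x

theorem hasCompactSupport_smul {G : Type*} [NormedAddCommGroup G] [NormedSpace ℝ G]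
    (ρ : Eu d → ℝ) (ψ : Eu d → G) (hψ : HasCompactSupport ψ) :
    HasCompactSupport fun x => ρ x • ψ x := hψ.smul_left

theorem tsupport_smul_subset {G : Type*} [NormedAddCommGroup G] [NormedSpace ℝ G]
    (ρ : Eu d → ℝ) (ψ : Eu d → G) : tsupport (fun x => ρ x • ψ x) ⊆ tsupport ρ :=
  closure_mono (Function.support_smul_subset_left _ _)

/-- The product of a test form and a smooth function. -/
def mulForm (ρ : Eu d → ℝ) (hρ : ContDiff ℝ (⊤ : ℕ∞) ρ) (ψ : TestForm d m) : TestForm d m where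
  toFun x := ρ x • ψ x
  contDiff' := hρ.smul ψ.contDiff
  hasCompactSupport' := hasCompactSupport_smul ρ ψ ψ.hasCompactSupport
  tsupport_subset' := by simp

/-- A smooth partition of unity subordinate to a finite open cover of a closed set. -/
theorem exists_partition {ι : Type} [Fintype ι] (K : Set (Eu d)) (hK : IsClosed K)
    (U : ι → Set (Eu d)) (hU : ∀ i, IsOpen (U i)) (h : K ⊆ ⋃ i, U i) :
    ∃ ρ : ι → Eu d → ℝ, (∀ i, ContDiff ℝ (⊤ : ℕ∞) (ρ i)) ∧ (∀ i, tsupport (ρ i) ⊆ U i) ∧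
      ∀ x ∈ K, ∑ i, ρ i x = 1 := by
  obtain ⟨ρ, hρ⟩ := SmoothPartitionOfUnity.exists_isSubordinate
    (modelWithCornersSelf ℝ (Eu d)) hK U hU h
  refine ⟨fun i => ρ i, fun i => (ρ i).contMDiff.contDiff, hρ, fun x hx => ?_⟩
  rw [← finsum_eq_sum_of_fintype]
  exact ρ.sum_eq_one hx

/-- A current vanishes on forms supported off its support. -/
theorem eq_zero_of_disjoint_spt (T : Current d m) (ψ : TestForm d m)
    (h : Disjoint (tsupport ψ) (spt T)) : T ψ = 0 := by
  have hloc : ∀ x : tsupport ψ, ∃ s : Set (Eu d),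
      Distribution.IsVanishingOn (fun ψ : TestForm d m => T ψ) s ∧ IsOpen s ∧ (x : Eu d) ∈ s :=
    fun x => (Distribution.notMem_dsupport_iff _).1 (disjoint_left.1 h x.2)
  choose U hU hUo hxU using hloc
  obtain ⟨t, ht⟩ := ψ.hasCompactSupport.isCompact.elim_finite_subcover U hUo
    (fun x hx => mem_iUnion.2 ⟨⟨x, hx⟩, hxU _⟩)
  obtain ⟨ρ, hsm, hsub, hone⟩ := exists_partition (tsupport ψ) (isClosed_tsupport ψ)
    (fun i : t => U i) (fun i => hUo i) (by simpa [iUnion_subtype] using ht)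
  have hsum : ψ = ∑ i, mulForm (ρ i) (hsm i) ψ := by
    ext1 x
    have h1 : (∑ i, mulForm (ρ i) (hsm i) ψ) x = ∑ i, ρ i x • ψ x :=
      sum_apply _ _ _
    rw [h1, ← Finset.sum_smul]
    by_cases hx : x ∈ tsupport ψ
    · rw [hone x hx, one_smul]
    · rw [image_eq_zero_of_notMem_tsupport hx, smul_zero]
  rw [hsum, map_sum]
  refine Finset.sum_eq_zero fun i _ => hU i _ ?_
  exact (tsupport_smul_subset (ρ i) ψ).trans (hsub i)

theorem tsupport_convForm_subset (φ : TestFun d) (ψ : TestForm d m) :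
    tsupport (convForm φ ψ) ⊆ tsupport ψ + tsupport φ :=
  closure_minimal ((support_convolution_subset_swap _).trans
    (add_subset_add subset_closure subset_closure))
    (ψ.hasCompactSupport.isCompact.add φ.hasCompactSupport.isCompact).isClosed

theorem mass_ne_top {T : Current d m} (hT : T ∈ NormalCurrents d m) : mass T ≠ ⊤ :=
  (ENNReal.add_ne_top.1 hT.2).1

theorem bdMass_ne_top {T : Current d m} (hT : T ∈ NormalCurrents d m) : bdMass T ≠ ⊤ :=
  (ENNReal.add_ne_top.1 hT.2).2

/-- A linear functional on test forms that is bounded by the supremum norm is a current. -/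
theorem continuous_of_bound (L : TestForm d m →ₗ[ℝ] ℝ) (C : ℝ)
    (h : ∀ (ψ : TestForm d m) (R : ℝ), (∀ x, ‖ψ x‖ ≤ R) → |L ψ| ≤ C * R) : Continuous L := by
  refine continuous_of_continuousAt_zero L ?_
  rw [ContinuousAt, map_zero]
  let B : TestForm d m →L[ℝ] BoundedContinuousFunction (Eu d) (Covector d m) :=
    TestFunction.toBoundedContinuousFunctionCLM ℝ
  have hb := B.continuous.norm.tendsto 0
  rw [map_zero, norm_zero] at hb
  have hb' := hb.const_mul C
  rw [mul_zero] at hb'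
  refine squeeze_zero_norm (fun ψ => ?_) hb'
  exact h ψ _ fun x => (B ψ).norm_coe_le_norm x

/-- The convolution `(T * φ)(ψ) = T (φ̌ * ψ)` of a current of finite mass and a test function. -/
def convCurrent (T : Current d m) (hT : mass T ≠ ⊤) (φ : TestFun d) : Current d m where
  toLinearMap := (T : TestForm d m →ₗ[ℝ] ℝ) ∘ₗ convForm (reflect φ)
  cont := continuous_of_bound _ ((mass T).toReal * ∫ y, ‖reflect φ y‖) fun ψ R hR => by
    rw [mul_assoc]
    exact abs_le_of_mass T hT _ _ (norm_convForm_le _ ψ R hR)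

theorem convCurrent_apply (T : Current d m) (hT : mass T ≠ ⊤) (φ : TestFun d)
    (ψ : TestForm d m) : convCurrent T hT φ ψ = T (convForm (reflect φ) ψ) := rfl

theorem mass_convCurrent (T : Current d m) (hT : mass T ≠ ⊤) (φ : TestFun d) :
    mass (convCurrent T hT φ) ≠ ⊤ := by
  refine ne_top_of_le_ne_top ENNReal.ofReal_ne_top (mass_le_of_bound _
    ((mass T).toReal * ((∫ y, ‖reflect φ y‖) * 1)) fun ψ hψ => ?_)
  exact (le_abs_self _).trans (abs_le_of_mass T hT _ _ (norm_convForm_le _ ψ 1 hψ))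

theorem bdMass_convCurrent : ∀ {m : ℕ} (T : Current d m) (hT : mass T ≠ ⊤) (_ : bdMass T ≠ ⊤)
    (φ : TestFun d), bdMass (convCurrent T hT φ) ≠ ⊤
  | 0, _, _, _, _ => by simp [bdMass]
  | m + 1, T, hT, hb, φ => by
      have : boundary (convCurrent T hT φ) = convCurrent (boundary T) hb φ := by
        ext ψ
        change T (convForm _ (extD ψ)) = T (extD (convForm _ ψ))
        rw [extD_convForm]
      change mass (boundary (convCurrent T hT φ)) ≠ ⊤
      rw [this]
      exact mass_convCurrent _ hb φ

theorem spt_convCurrent_subset (T : Current d m) (hT : mass T ≠ ⊤) (hc : IsCompact (spt T))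
    (φ : TestFun d) : spt (convCurrent T hT φ) ⊆ spt T + tsupport φ := by
  intro x hx
  have hK : IsClosed (spt T + tsupport φ) := (hc.add φ.hasCompactSupport.isCompact).isClosed
  refine (Distribution.mem_dsupport_iff x).1 hx _ (fun ψ hψ => ?_) hK
  refine eq_zero_of_disjoint_spt T _ (disjoint_left.2 fun z hz hzT => ?_)
  obtain ⟨a, ha, b, hb, rfl⟩ := tsupport_convForm_subset _ _ hz
  have hb' : -b ∈ tsupport φ := by
    have := tsupport_comp_subset_preimage (φ : Eu d → ℝ) (f := fun x => -x) continuous_neg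
    exact this hb
  exact hψ ha ⟨a + b, hzT, -b, hb', by simp⟩

/-- The convolution `T * φ` of a normal current and a test function, as a normal current;
`(T * φ)(ψ) = T (φ̌ * ψ)`. -/
def nconv (T : NormalCurrents d m) (φ : TestFun d) : NormalCurrents d m :=
  ⟨convCurrent T.1 (mass_ne_top T.2) φ,
    (T.2.1.add φ.hasCompactSupport.isCompact).of_isClosed_subset Distribution.isClosed_dsupport
      (spt_convCurrent_subset T.1 (mass_ne_top T.2) T.2.1 φ),
    ENNReal.add_ne_top.2 ⟨mass_convCurrent _ _ φ,
      bdMass_convCurrent _ _ (bdMass_ne_top T.2) φ⟩⟩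

theorem nconv_apply (T : NormalCurrents d m) (φ : TestFun d) (ψ : TestForm d m) :
    (nconv T φ : Current d m) ψ = (T : Current d m) (convForm (reflect φ) ψ) := rfl

/-! ### Charges -/

/-- Linear functionals on the space of normal currents. -/
abbrev Functional (d m : ℕ) : Type := NormalCurrents d m →ₗ[ℝ] ℝ

/-- `ω` is an `m`-charge over `ℝ^d`: for every compact `K`, `ω(T_n) → 0` for every
`N`-bounded sequence in `N_m(K)` that tends to `0` in flat norm. -/
def IsCharge (ω : Functional d m) : Prop :=
  ∀ K : Set (Eu d), IsCompact K → ∀ T : ℕ → NormalCurrents d m,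
    (∀ n, spt (T n : Current d m) ⊆ K) →
    (∃ c : ℝ≥0, ∀ n, normalMass (T n : Current d m) ≤ c) →
    Tendsto (fun n => flatNorm (T n : Current d m)) atTop (𝓝 0) →
    Tendsto (fun n => ω (T n)) atTop (𝓝 0)

/-- `|ω(T)| ≤ C N(T)^{1-α} F(T)^α` for all `T ∈ N_m(K)`. -/
def FracBound (α : ℝ) (K : Set (Eu d)) (ω : Functional d m) (C : ℝ≥0) : Prop :=
  ∀ T : NormalCurrents d m, spt (T : Current d m) ⊆ K →
    |ω T| ≤ C * (normalMass (T : Current d m)).toReal ^ (1 - α) *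
      (flatNorm (T : Current d m)).toReal ^ α

/-- `CH^{m,α}(ℝ^d)`: the charges whose restriction to each compact set is `α`-fractional. -/
def IsFracCharge (α : ℝ) (ω : Functional d m) : Prop :=
  IsCharge ω ∧ ∀ K : Set (Eu d), IsCompact K → ∃ C : ℝ≥0, FracBound α K ω C

/-- The seminorm of `CH^{m,α}(K)`: the infimum of the constants in the fractional bound
(`∞` if there is none). -/
def fracNorm (α : ℝ) (K : Set (Eu d)) (ω : Functional d m) : ℝ≥0∞ :=
  ⨅ (C : ℝ≥0) (_ : FracBound α K ω C), (C : ℝ≥0∞)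

/-- The seminorm `‖ω‖_{CH^m(K)} = sup {ω(T) : T ∈ N_m(K), N(T) ≤ 1}`. -/
def chargeNorm (K : Set (Eu d)) (ω : Functional d m) : ℝ≥0∞ :=
  ⨆ (T : NormalCurrents d m) (_ : spt (T : Current d m) ⊆ K ∧
    normalMass (T : Current d m) ≤ 1), ENNReal.ofReal (ω T)

/-- Weak* convergence of a sequence in `CH^{m,α}(ℝ^d)`: it is bounded in `CH^{m,α}(ℝ^d)`
and converges in `CH^m(ℝ^d)`. -/
def WeakStarTendsto (α : ℝ) (ω : ℕ → Functional d m) (ω₀ : Functional d m) : Prop :=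
  (∀ n, IsFracCharge α (ω n)) ∧ IsFracCharge α ω₀ ∧
  ∀ K : Set (Eu d), IsCompact K →
    (⨆ n, fracNorm α K (ω n)) < ⊤ ∧
    Tendsto (fun n => chargeNorm K (ω n - ω₀)) atTop (𝓝 0)

/-- The convolution `(ω * φ)(T) = ω (T * φ̌)` of a charge and a test function. -/
def chargeConv (ω : Functional d m) (φ : TestFun d) : Functional d m where
  toFun T := ω (nconv T (reflect φ))
  map_add' S T := by
    rw [← map_add]
    congr 1
  map_smul' c T := by
    rw [RingHom.id_apply, ← map_smul]
    congr 1

/-- The functional `ω` is given by the form `η`, i.e. `ω(T) = T(η)` for all normal `T`. Here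
`η` need not have compact support but `T` has, and `T(η)` means `T(ψ)` for any compactly
supported smooth form `ψ` that agrees with `η` near the support of `T`. -/
def IsGivenBy (ω : Functional d m) (η : Eu d → Covector d m) : Prop :=
  ∀ (T : NormalCurrents d m) (ψ : TestForm d m),
    (∀ᶠ x in 𝓝ˢ (spt (T : Current d m)), ψ x = η x) → ω T = (T : Current d m) ψ

/-! ### Mollification -/

/-- `Φ` is nonnegative, even, of integral one, with support in the closed unit ball. -/
structure IsMollifier (Φ : TestFun d) : Prop where
  tsupport_subset : tsupport Φ ⊆ Metric.closedBall 0 1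
  nonneg : ∀ x, 0 ≤ Φ x
  even : ∀ x, Φ (-x) = Φ x
  integral_eq_one : ∫ x, Φ x = 1

/-- The rescaling `Φ_ε(x) = ε^{-d} Φ(ε^{-1} x)`. -/
def rescale (Φ : TestFun d) (ε : ℝ) (hε : 0 < ε) : TestFun d where
  toFun x := (ε ^ d)⁻¹ * Φ (ε⁻¹ • x)
  contDiff' := contDiff_const.mul (Φ.contDiff.comp (contDiff_const_smul _))
  hasCompactSupport' :=
    (Φ.hasCompactSupport.comp_homeomorph
      (Homeomorph.smulOfNeZero ε⁻¹ (inv_ne_zero hε.ne'))).mul_left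
  tsupport_subset' := by simp

end FracCharge

end

open FracCharge

noncomputable section

namespace FracCharge

open LineDeriv

variable {d m : ℕ}

/-! ### Derivatives of convolutions -/

/-! The two reflections in the definitions cancel: $(\omega*\varphi)(T)=\omega(T_\varphi)$ with
$T_\varphi(\psi)=T(\varphi*\psi)$ (`mollify`). Every estimate on $\omega*\Phi_\varepsilon$ is
therefore an estimate on $T_{\Phi_\varepsilon}$, inserted into $|\omega(S)|\le
c\,N(S)^{1-\alpha}F(S)^\alpha$; mollifying enlarges supports by at most $\varepsilon$, which
accounts for $K_\varepsilon$.

Convolution with a kernel of $L^1$-norm at most one contracts the comass and commutes with $d$, so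
$T\mapsto T_{\Phi_\varepsilon}$ contracts both $N$ and $F$: this is (A). Moving derivatives onto the
kernel gives $\|d(\Phi_\varepsilon*\psi)\|\le C\varepsilon^{-1}\|\psi\|$, hence
$N(T_{\Phi_\varepsilon})\le C\varepsilon^{-1}F(T)$ (`realNormalMass_mollify_le_realFlatNorm`), and
(B) follows by interpolation. For (C) the point is $F(T-T_{\Phi_\varepsilon})\le C\varepsilon N(T)$
(`realFlatNorm_sub_mollify_le`): the $t$-derivative of $\Phi_t*\psi$ is $-\sum_i
(x_i\Phi)_t*\partial_i\psi$, and Cartan's formula $\partial_v=\iota_v d+d\iota_v$ bounds $T$ on it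
by $N(T)$ when $\|\psi\|,\|d\psi\|\le1$. Weak-* convergence follows from (A) and (C).

The density $\eta$ of $\omega*\varphi$ is determined by $l(\eta(x))=\omega(\psi\mapsto
l((\varphi*\psi)(x)))$ for linear functionals $l$ on covectors. It is smooth because the Taylor
remainder of $x\mapsto(\psi\mapsto l((\varphi*\psi)(x)))$ is quadratically small in normal mass, and
its partial derivatives have the same form with $\partial_i\varphi$ for $\varphi$. It represents
$\omega*\varphi$ because $T_\varphi$ is a flat limit, with bounded normal mass, of finite sums of
such smeared evaluations at points of the support of $T$; on these sums $\omega$ gives Riemann sums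
for $T(\eta)$. -/

instance finiteDimensional_covector (d m : ℕ) : FiniteDimensional ℝ (Covector d m) := by
  let f : Covector d m →ₗ[ℝ] MultilinearMap ℝ (fun _ : Fin m => Eu d) ℝ :=
    { toFun := fun η => η.toMultilinearMap
      map_add' := fun _ _ => rfl
      map_smul' := fun _ _ => rfl }
  refine FiniteDimensional.of_injective f fun η ξ h => ?_
  ext v
  exact congrArg (fun g : MultilinearMap ℝ (fun _ : Fin m => Eu d) ℝ => g v) h

theorem lineDerivOp_testFunction_apply {G : Type*} [NormedAddCommGroup G] [NormedSpace ℝ G] (v : Eu d)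
    (f : 𝓓((⊤ : TopologicalSpace.Opens (Eu d)), G)) (x : Eu d) :
    (∂_{v} f) x = fderiv ℝ f x v := by
  rw [TestFunction.lineDerivOp_eq_lineDerivCLM ℝ, TestFunction.lineDerivCLM_eq_fderivCLM]
  simp

theorem differentiable_testFunction {G : Type*} [NormedAddCommGroup G] [NormedSpace ℝ G]
    (f : 𝓓((⊤ : TopologicalSpace.Opens (Eu d)), G)) : Differentiable ℝ f :=
  f.contDiff.differentiable (by simp)

/-- The integral of the norm of the gradient. -/
def gradInt (φ : TestFun d) : ℝ := ∫ y, ‖fderiv ℝ φ y‖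

theorem gradInt_nonneg (φ : TestFun d) : 0 ≤ gradInt φ := integral_nonneg fun _ => norm_nonneg _

theorem integrable_norm_fderiv (φ : TestFun d) :
    Integrable (fun y => ‖fderiv ℝ φ y‖) (volume : Measure (Eu d)) :=
  ((φ.contDiff.continuous_fderiv (by simp)).integrable_of_hasCompactSupport
    (φ.hasCompactSupport.fderiv ℝ)).norm

theorem fderiv_conv_left_apply {G : Type*} [NormedAddCommGroup G] [NormedSpace ℝ G]
    (φ : TestFun d) (ψ : Eu d → G) (hψ : Continuous ψ) (x v : Eu d) :
    fderiv ℝ ((φ : Eu d → ℝ) ⋆[ContinuousLinearMap.lsmul ℝ ℝ, volume] ψ) x v =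
      ∫ y, fderiv ℝ φ y v • ψ (x - y) := by
  have h := φ.hasCompactSupport.hasFDerivAt_convolution_left
    (ContinuousLinearMap.lsmul ℝ ℝ) (μ := volume) (φ.contDiff.of_le (by simp))
    (hψ.locallyIntegrable) x
  have hi := (φ.hasCompactSupport.fderiv ℝ).convolutionExists_left
    ((ContinuousLinearMap.lsmul ℝ ℝ : ℝ →L[ℝ] G →L[ℝ] G).precompL (Eu d))
    (μ := volume) (φ.contDiff.continuous_fderiv (by simp)) hψ.locallyIntegrable x
  rw [h.fderiv, convolution_def, ContinuousLinearMap.integral_apply hi]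
  rfl

theorem fderiv_convForm_apply (φ : TestFun d) (ψ : TestForm d m) (x v : Eu d) :
    fderiv ℝ (convForm φ ψ) x v = convForm (∂_{v} φ) ψ x := by
  rw [convForm_apply]
  simp only [lineDerivOp_testFunction_apply]
  exact fderiv_conv_left_apply φ ψ ψ.continuous x v

theorem fderiv_convForm_apply_right (φ : TestFun d) (ψ : TestForm d m) (x v : Eu d) :
    fderiv ℝ (convForm φ ψ) x v = convForm φ (∂_{v} ψ) x := by
  rw [convForm_apply]
  simp only [lineDerivOp_testFunction_apply]
  exact fderiv_conv_comp (ContinuousLinearMap.apply ℝ (Covector d m) v)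
    φ (locallyIntegrable φ) ψ (ψ.contDiff.of_le (by simp)) ψ.hasCompactSupport x

/-- The derivative falls on the kernel, so only the supremum of `ψ` enters. Such bounds can be used
for every form admitted in the definition of the mass. -/
theorem norm_fderiv_convForm_le (φ : TestFun d) (ψ : TestForm d m) (R : ℝ)
    (hR : ∀ x, ‖ψ x‖ ≤ R) (x : Eu d) : ‖fderiv ℝ (convForm φ ψ) x‖ ≤ gradInt φ * R := by
  have hR0 : 0 ≤ R := (norm_nonneg _).trans (hR 0)
  refine ContinuousLinearMap.opNorm_le_bound _ (mul_nonneg (gradInt_nonneg φ) hR0) fun v => ?_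
  rw [fderiv_convForm_apply]
  refine (norm_convForm_le _ ψ R hR x).trans ?_
  rw [mul_right_comm]
  gcongr
  rw [gradInt, ← integral_mul_const]
  refine integral_mono (integrable_testFun _).norm ((integrable_norm_fderiv φ).mul_const _)
    fun y => ?_
  rw [lineDerivOp_testFunction_apply]
  exact ContinuousLinearMap.le_opNorm _ _

theorem norm_extD_convForm_le (φ : TestFun d) (ψ : TestForm d m) (R : ℝ)
    (hR : ∀ x, ‖ψ x‖ ≤ R) (x : Eu d) :
    ‖extD (convForm φ ψ) x‖ ≤ (m + 1) * (gradInt φ * R) := by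
  rw [extD_apply]
  refine (ContinuousAlternatingMap.norm_alternatizeUncurryFin_le _).trans ?_
  gcongr
  exact norm_fderiv_convForm_le φ ψ R hR x

theorem norm_convForm_sub_le (φ : TestFun d) (ψ : TestForm d m) (R : ℝ)
    (hR : ∀ x, ‖ψ x‖ ≤ R) (x y : Eu d) :
    ‖convForm φ ψ x - convForm φ ψ y‖ ≤ gradInt φ * R * ‖x - y‖ :=
  convex_univ.norm_image_sub_le_of_norm_fderiv_le
    (fun z _ => differentiable_testFunction _ z)
    (fun z _ => norm_fderiv_convForm_le φ ψ R hR z) (mem_univ y) (mem_univ x)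

theorem extD_extD (ψ : TestForm d m) : extD (extD ψ) = 0 := by
  ext1 x
  rw [extD_apply]
  have : (extD ψ : Eu d → Covector d (m + 1)) = extDeriv ψ := funext (extD_apply ψ)
  rw [this]
  exact extDeriv_extDeriv_apply (r := (⊤ : ℕ∞)) ψ.contDiff.contDiffAt (by
    rw [minSmoothness_of_isRCLikeNormedField]; exact WithTop.coe_le_coe.2 le_top)

theorem reflect_reflect (φ : TestFun d) : reflect (reflect φ) = φ := by
  ext1 x
  change φ (- -x) = φ x
  rw [neg_neg]

/-- The change of variables absorbs $\varepsilon^{-d}$ and the chain rule leaves one factor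
$\varepsilon^{-1}$, the source of the power $\varepsilon^{\alpha-1}$ in (B). -/
theorem gradInt_rescale (φ : TestFun d) (ε : ℝ) (hε : 0 < ε) :
    gradInt (rescale φ ε hε) = ε⁻¹ * gradInt φ := by
  have h (y : Eu d) : ‖fderiv ℝ (rescale φ ε hε) y‖ =
      (ε ^ d)⁻¹ * ε⁻¹ * ‖fderiv ℝ φ (ε⁻¹ • y)‖ := by
    have h1 : HasFDerivAt (rescale φ ε hε)
        ((ε ^ d)⁻¹ • (fderiv ℝ φ (ε⁻¹ • y)).comp (ε⁻¹ • ContinuousLinearMap.id ℝ (Eu d))) y := by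
      refine HasFDerivAt.const_mul ?_ _
      exact (differentiable_testFunction φ _).hasFDerivAt.comp y
        ((hasFDerivAt_id y).const_smul ε⁻¹)
    rw [h1.fderiv, ContinuousLinearMap.comp_smul, ContinuousLinearMap.comp_id, norm_smul,
      norm_smul, Real.norm_of_nonneg (by positivity), Real.norm_of_nonneg (by positivity),
      mul_assoc]
  rw [gradInt, gradInt]
  simp only [h]
  rw [integral_const_mul, Measure.integral_comp_inv_smul_of_nonneg volume
    (fun y => ‖fderiv ℝ φ y‖) hε.le]
  simp only [finrank_euclideanSpace, Fintype.card_fin, smul_eq_mul]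
  field_simp

/-- The dilation moves from the kernel to the argument of the form, where the dependence on the
scale can be differentiated by expanding `ψ`. -/
theorem convForm_rescale_apply (φ : TestFun d) (ε : ℝ) (hε : 0 < ε) (ψ : TestForm d m)
    (x : Eu d) : convForm (rescale φ ε hε) ψ x = ∫ y, φ y • ψ (x - ε • y) := by
  have h := Measure.integral_comp_inv_smul_of_nonneg volume
    (fun y : Eu d => φ y • ψ (x - ε • y)) hε.le
  simp only [finrank_euclideanSpace, Fintype.card_fin, smul_inv_smul₀ hε.ne'] at h
  rw [convForm_apply, ← inv_smul_smul₀ (pow_pos hε d).ne' (∫ y, φ y • ψ (x - ε • y)), ← h,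
    ← integral_smul]
  refine integral_congr_ae (Eventually.of_forall fun y => ?_)
  simp only [smul_smul]
  rfl

theorem integral_norm_rescale (φ : TestFun d) (ε : ℝ) (hε : 0 < ε) :
    ∫ y, ‖rescale φ ε hε y‖ = ∫ y, ‖φ y‖ := by
  have h := Measure.integral_comp_inv_smul_of_nonneg volume (fun y : Eu d => ‖φ y‖) hε.le
  simp only [finrank_euclideanSpace, Fintype.card_fin] at h
  have h1 (y : Eu d) : ‖rescale φ ε hε y‖ = (ε ^ d)⁻¹ * ‖φ (ε⁻¹ • y)‖ := by
    change ‖(ε ^ d)⁻¹ * φ (ε⁻¹ • y)‖ = _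
    rw [norm_mul, Real.norm_of_nonneg (by positivity)]
  simp only [h1]
  rw [integral_const_mul, h, smul_eq_mul, inv_mul_cancel_left₀ (pow_pos hε d).ne']

/-- The second order Taylor estimate for a function with Lipschitz derivative. -/
theorem norm_taylor_le_of_lipschitz {E G : Type*} [NormedAddCommGroup E] [NormedSpace ℝ E]
    [NormedAddCommGroup G] [NormedSpace ℝ G] (f : E → G) (hf : Differentiable ℝ f) (C : ℝ)
    (hC0 : 0 ≤ C) (hlip : ∀ x z : E, ‖fderiv ℝ f z - fderiv ℝ f x‖ ≤ C * ‖z - x‖) (x h : E) :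
    ‖f (x + h) - f x - fderiv ℝ f x h‖ ≤ C * ‖h‖ ^ 2 := by
  have hseg (z : E) (hz : z ∈ segment ℝ x (x + h)) :
      ‖fderiv ℝ f z - fderiv ℝ f x‖ ≤ C * ‖h‖ := by
    refine (hlip x z).trans (mul_le_mul_of_nonneg_left ?_ hC0)
    obtain ⟨t, ⟨ht0, ht1⟩, rfl⟩ := (segment_eq_image' ℝ x (x + h)).subset hz
    simp only [add_sub_cancel_left, norm_smul, Real.norm_of_nonneg ht0]
    exact mul_le_of_le_one_left (norm_nonneg _) ht1
  have key := (convex_segment x (x + h)).norm_image_sub_le_of_norm_fderiv_le'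
    (fun z _ => hf z) hseg (left_mem_segment ℝ _ _) (right_mem_segment ℝ _ _)
  rw [add_sub_cancel_left] at key
  rwa [pow_two, ← mul_assoc]

/-- The second order Taylor estimate for a compactly supported `C²` function. -/
theorem exists_taylor_bound {E G : Type*} [NormedAddCommGroup E] [NormedSpace ℝ E]
    [NormedAddCommGroup G] [NormedSpace ℝ G] (f : E → G) (hf : ContDiff ℝ 2 f)
    (hc : HasCompactSupport f) :
    ∃ C : ℝ, 0 ≤ C ∧ ∀ x h : E, ‖f (x + h) - f x - fderiv ℝ f x h‖ ≤ C * ‖h‖ ^ 2 := by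
  have h1 : ContDiff ℝ 1 (fderiv ℝ f) := hf.fderiv_right (m := 1) (by norm_num)
  obtain ⟨C, hC⟩ := h1.lipschitzWith_of_hasCompactSupport (hc.fderiv ℝ) one_ne_zero
  refine ⟨C, C.2, norm_taylor_le_of_lipschitz f (hf.differentiable two_ne_zero) C C.2
    fun x z => ?_⟩
  rw [← dist_eq_norm, ← dist_eq_norm]
  exact hC.dist_le_mul z x

/-! ### Currents -/

theorem spt_subset_of_forall {T : Current d m} {K : Set (Eu d)} (hK : IsClosed K)
    (h : ∀ ψ : TestForm d m, Disjoint (tsupport ψ) K → T ψ = 0) : spt T ⊆ K := fun x hx =>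
  (Distribution.mem_dsupport_iff x).1 hx _
    (fun ψ hψ => h ψ (disjoint_left.2 fun _ hz => hψ hz)) hK

/-- Two currents with support in a closed set have a difference with support in it. -/
theorem spt_sub_subset {S T : Current d m} {K : Set (Eu d)} (hS : spt S ⊆ K) (hT : spt T ⊆ K) :
    spt (S - T) ⊆ K := by
  rw [sub_eq_add_neg, ← neg_one_smul ℝ T]
  exact (spt_add_subset _ _).trans (union_subset hS ((spt_smul_subset _ _).trans hT))

/-- Quantifying over `k` with `k + 1 = m` treats all degrees at once: for `m = 0` the hypothesis is
vacuous, in accordance with the boundary being zero. -/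
theorem bdMass_le_of_bound : ∀ {m : ℕ} (T : Current d m) (C : ℝ),
    (∀ (k : ℕ) (e : k + 1 = m) (ψ : TestForm d k), (∀ x, ‖ψ x‖ ≤ 1) → T (e ▸ extD ψ) ≤ C) →
    bdMass T ≤ ENNReal.ofReal C
  | 0, _, _, _ => by simp [bdMass]
  | k + 1, T, C, h => mass_le_of_bound _ _ fun ψ hψ => h k rfl ψ hψ

/-- A bound on the normal mass from bounds on the current and its boundary. -/
theorem normalMass_le_of_bound (T : Current d m) (a b : ℝ) (ha : 0 ≤ a) (hb : 0 ≤ b)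
    (h1 : ∀ ψ : TestForm d m, (∀ x, ‖ψ x‖ ≤ 1) → T ψ ≤ a)
    (h2 : ∀ (k : ℕ) (e : k + 1 = m) (ψ : TestForm d k), (∀ x, ‖ψ x‖ ≤ 1) →
      T (e ▸ extD ψ) ≤ b) : normalMass T ≤ ENNReal.ofReal (a + b) := by
  rw [ENNReal.ofReal_add ha hb]
  exact add_le_add (mass_le_of_bound T a h1) (bdMass_le_of_bound T b h2)

/-- The normal mass as a real number. -/
def realNormalMass (T : NormalCurrents d m) : ℝ := (normalMass (T : Current d m)).toReal

/-- The flat norm as a real number. -/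
def realFlatNorm (T : NormalCurrents d m) : ℝ := (flatNorm (T : Current d m)).toReal

theorem realNormalMass_nonneg (T : NormalCurrents d m) : 0 ≤ realNormalMass T :=
  ENNReal.toReal_nonneg

theorem realFlatNorm_nonneg (T : NormalCurrents d m) : 0 ≤ realFlatNorm T :=
  ENNReal.toReal_nonneg

theorem flatNorm_le_mass (T : Current d m) : flatNorm T ≤ mass T :=
  iSup₂_le fun ψ hψ => le_iSup₂_of_le ψ (fun x => (hψ x).1) le_rfl

theorem flatNorm_ne_top (T : NormalCurrents d m) : flatNorm (T : Current d m) ≠ ⊤ :=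
  ne_top_of_le_ne_top (mass_ne_top T.2) (flatNorm_le_mass _)

theorem realFlatNorm_le_realNormalMass (T : NormalCurrents d m) :
    realFlatNorm T ≤ realNormalMass T :=
  ENNReal.toReal_mono T.2.2 ((flatNorm_le_mass _).trans le_self_add)

theorem realNormalMass_eq (T : NormalCurrents d m) : realNormalMass T =
    (mass (T : Current d m)).toReal + (bdMass (T : Current d m)).toReal :=
  ENNReal.toReal_add (mass_ne_top T.2) (bdMass_ne_top T.2)

theorem abs_le_of_bdMass (T : NormalCurrents d m) (k : ℕ) (e : k + 1 = m) (ψ : TestForm d k)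
    (R : ℝ) (hR : ∀ x, ‖ψ x‖ ≤ R) :
    |(T : Current d m) (e ▸ extD ψ)| ≤ (bdMass (T : Current d m)).toReal * R := by
  subst e
  exact abs_le_of_mass (boundary (T : Current d (k + 1))) (bdMass_ne_top T.2) ψ R hR

theorem realNormalMass_le (T : NormalCurrents d m) (C : ℝ) (hC : 0 ≤ C)
    (h : normalMass (T : Current d m) ≤ ENNReal.ofReal C) : realNormalMass T ≤ C :=
  ENNReal.toReal_le_of_le_ofReal hC h

theorem realFlatNorm_le (T : NormalCurrents d m) (C : ℝ) (hC : 0 ≤ C)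
    (h : ∀ ψ : TestForm d m, (∀ x, ‖ψ x‖ ≤ 1) → (∀ x, ‖extD ψ x‖ ≤ 1) →
      (T : Current d m) ψ ≤ C) : realFlatNorm T ≤ C :=
  ENNReal.toReal_le_of_le_ofReal hC (iSup₂_le fun ψ hψ => ENNReal.ofReal_le_ofReal
    (h ψ (fun x => (hψ x).1) fun x => (extD_apply ψ x).symm ▸ (hψ x).2))

theorem le_of_realFlatNorm (T : NormalCurrents d m) (ψ : TestForm d m) (R : ℝ) (hR0 : 0 < R)
    (h1 : ∀ x, ‖ψ x‖ ≤ R) (h2 : ∀ x, ‖extD ψ x‖ ≤ R) :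
    (T : Current d m) ψ ≤ realFlatNorm T * R := by
  have h3 : ENNReal.ofReal ((T : Current d m) (R⁻¹ • ψ)) ≤ flatNorm (T : Current d m) := by
    refine le_iSup₂_of_le (R⁻¹ • ψ) (fun x => ?_) le_rfl
    rw [← extD_apply, map_smul]
    have (n : ℕ) (χ : TestForm d n) : ‖(R⁻¹ • χ) x‖ = R⁻¹ * ‖χ x‖ := by
      simp [norm_smul, abs_of_pos hR0]
    rw [this, this, inv_mul_le_iff₀ hR0, inv_mul_le_iff₀ hR0, mul_one]
    exact ⟨h1 x, h2 x⟩
  have h4 := (ENNReal.ofReal_le_iff_le_toReal (flatNorm_ne_top T)).1 h3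
  rw [map_smul, smul_eq_mul, inv_mul_le_iff₀ hR0] at h4
  rw [mul_comm]
  exact h4

/-! ### Mollification of normal currents -/

/-- The normal current `ψ ↦ T (φ * ψ)`. -/
def mollify (T : NormalCurrents d m) (φ : TestFun d) : NormalCurrents d m := nconv T (reflect φ)

theorem mollify_apply (T : NormalCurrents d m) (φ : TestFun d) (ψ : TestForm d m) :
    (mollify T φ : Current d m) ψ = (T : Current d m) (convForm φ ψ) := by
  rw [mollify, nconv_apply, reflect_reflect]

theorem chargeConv_apply (ω : Functional d m) (φ : TestFun d) (T : NormalCurrents d m) :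
    chargeConv ω φ T = ω (mollify T φ) := rfl

theorem mollify_extD_apply (T : NormalCurrents d m) (φ : TestFun d) (k : ℕ) (e : k + 1 = m)
    (ψ : TestForm d k) : (mollify T φ : Current d m) (e ▸ extD ψ) =
      (T : Current d m) (e ▸ extD (convForm φ ψ)) := by
  subst e
  rw [mollify_apply, extD_convForm]

theorem spt_mollify_subset (T : NormalCurrents d m) (φ : TestFun d) :
    spt (mollify T φ : Current d m) ⊆ spt (T : Current d m) + tsupport (reflect φ) :=
  spt_convCurrent_subset _ (mass_ne_top T.2) T.2.1 _

theorem norm_convForm_le_of_le (φ : TestFun d) (hφ : ∫ y, ‖φ y‖ ≤ 1) (ψ : TestForm d m) (R : ℝ)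
    (hR : ∀ x, ‖ψ x‖ ≤ R) (x : Eu d) : ‖convForm φ ψ x‖ ≤ R :=
  (norm_convForm_le φ ψ R hR x).trans
    (mul_le_of_le_one_left ((norm_nonneg _).trans (hR 0)) hφ)

theorem realNormalMass_mollify_le (T : NormalCurrents d m) (φ : TestFun d)
    (hφ : ∫ y, ‖φ y‖ ≤ 1) : realNormalMass (mollify T φ) ≤ realNormalMass T := by
  refine realNormalMass_le _ _ (realNormalMass_nonneg T) ?_
  rw [realNormalMass_eq]
  refine normalMass_le_of_bound _ _ _ ENNReal.toReal_nonneg ENNReal.toReal_nonneg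
    (fun ψ hψ => ?_) (fun k e ψ hψ => ?_)
  · rw [mollify_apply]
    simpa using (le_abs_self _).trans
      (abs_le_of_mass _ (mass_ne_top T.2) _ 1 (norm_convForm_le_of_le φ hφ ψ 1 hψ))
  · rw [mollify_extD_apply]
    simpa using (le_abs_self _).trans
      (abs_le_of_bdMass T k e _ 1 (norm_convForm_le_of_le φ hφ ψ 1 hψ))

theorem realFlatNorm_mollify_le (T : NormalCurrents d m) (φ : TestFun d)
    (hφ : ∫ y, ‖φ y‖ ≤ 1) : realFlatNorm (mollify T φ) ≤ realFlatNorm T := by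
  refine realFlatNorm_le _ _ (realFlatNorm_nonneg T) fun ψ h1 h2 => ?_
  rw [mollify_apply]
  refine (le_of_realFlatNorm T _ 1 one_pos (norm_convForm_le_of_le φ hφ ψ 1 h1) ?_).trans
    (mul_one _).le
  rw [extD_convForm]
  exact norm_convForm_le_of_le φ hφ _ 1 h2

/-- Smoothing makes every form of comass at most one admissible for the flat norm, up to the factor
`B`. For the mass this is the gradient bound on `φ * ψ`; for the boundary the tested form `d(φ * ψ)`
is closed, so only its comass counts. -/
theorem realNormalMass_mollify_le_realFlatNorm (T : NormalCurrents d m) (φ : TestFun d)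
    (hφ : ∫ y, ‖φ y‖ ≤ 1) (B : ℝ) (hB : 1 ≤ B) (hB' : (m + 1) * gradInt φ ≤ B) :
    realNormalMass (mollify T φ) ≤ 2 * B * realFlatNorm T := by
  have hB0 : 0 < B := one_pos.trans_le hB
  have h0 : 0 ≤ realFlatNorm T * B := mul_nonneg (realFlatNorm_nonneg T) hB0.le
  rw [show 2 * B * realFlatNorm T = realFlatNorm T * B + realFlatNorm T * B by ring]
  refine realNormalMass_le _ _ (add_nonneg h0 h0) ?_
  refine normalMass_le_of_bound _ _ _ h0 h0 (fun ψ hψ => ?_) (fun k e ψ hψ => ?_)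
  · rw [mollify_apply]
    refine le_of_realFlatNorm T _ B hB0 (fun x => ?_) (fun x => ?_)
    · exact (norm_convForm_le_of_le φ hφ ψ 1 hψ x).trans hB
    · refine (norm_extD_convForm_le φ ψ 1 hψ x).trans ?_
      rwa [mul_one]
  · rw [mollify_extD_apply]
    subst e
    refine le_of_realFlatNorm T _ B hB0 (fun x => ?_) (fun x => ?_)
    -- Here `ψ` has degree `k = m - 1`, so the factor `k + 1` is at most `m + 1`.
    · refine (norm_extD_convForm_le φ ψ 1 hψ x).trans (le_trans ?_ hB')
      rw [mul_one]
      gcongr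
      · exact gradInt_nonneg φ
      · simp
    · rw [extD_extD]
      simpa using hB0.le

/-! ### Cartan's formula -/

/-- The contraction of a test form with a constant vector field. -/
def contract (v : Eu d) : TestForm d (m + 1) →L[ℝ] TestForm d m :=
  TestFunction.postcompCLM ((ContinuousLinearMap.apply ℝ (Covector d m) v).comp
    (ContinuousAlternatingMap.curryLeftLI
      (𝕜 := ℝ) (E := Eu d) (F := ℝ) (n := m)).toContinuousLinearMap)

theorem contract_apply (v : Eu d) (ψ : TestForm d (m + 1)) (x : Eu d) :
    contract v ψ x = (ψ x).curryLeft v := by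
  simp [contract]

theorem norm_contract_le (v : Eu d) (hv : ‖v‖ ≤ 1) (ψ : TestForm d (m + 1)) (R : ℝ)
    (hR : ∀ x, ‖ψ x‖ ≤ R) (x : Eu d) : ‖contract v ψ x‖ ≤ R := by
  rw [contract_apply]
  refine ((ψ x).curryLeft.le_opNorm v).trans ?_
  rw [ContinuousAlternatingMap.norm_curryLeft]
  exact (mul_le_of_le_one_right (norm_nonneg _) hv).trans (hR x)

theorem lineDeriv_eq_contract_zero (v : Eu d) (ψ : TestForm d 0) :
    ∂_{v} ψ = contract v (extD ψ) := by
  ext x w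
  rw [contract_apply, extD_apply, lineDerivOp_testFunction_apply,
    ContinuousAlternatingMap.curryLeft_apply_apply, extDeriv,
    ContinuousAlternatingMap.alternatizeUncurryFin_apply, Fin.sum_univ_succ, Fin.sum_univ_zero]
  simp only [Matrix.cons_val_zero, Fin.val_zero, pow_zero, one_smul, add_zero]
  congr 1

/-- In the alternating sum for $d\psi(v,w_0,\dots,w_m)$ the term of index zero is
$\partial_v\psi(w)$. Each later term keeps `v` in front and deletes one $w_i$, with the sign
opposite to that in $d(\iota_v\psi)(w)$; these terms cancel. -/
theorem lineDeriv_eq_contract_succ (v : Eu d) (ψ : TestForm d (m + 1)) :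
    ∂_{v} ψ = contract v (extD ψ) + extD (contract v ψ) := by
  ext x w
  have hd : HasFDerivAt (contract v ψ)
      (((ContinuousLinearMap.apply ℝ (Covector d m) v).comp
        (ContinuousAlternatingMap.curryLeftLI
          (𝕜 := ℝ) (E := Eu d) (F := ℝ) (n := m)).toContinuousLinearMap).comp (fderiv ℝ ψ x)) x :=
    ContinuousLinearMap.hasFDerivAt _ |>.comp x (differentiable_testFunction ψ x).hasFDerivAt
  rw [add_apply, contract_apply, extD_apply, extD_apply, lineDerivOp_testFunction_apply,
    ContinuousAlternatingMap.add_apply,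
    ContinuousAlternatingMap.curryLeft_apply_apply, extDeriv, extDeriv, hd.fderiv,
    ContinuousAlternatingMap.alternatizeUncurryFin_apply,
    ContinuousAlternatingMap.alternatizeUncurryFin_apply, Fin.sum_univ_succ]
  have h1 (i : Fin (m + 1)) : (i.succ.removeNth (Matrix.vecCons v w) : Fin (m + 1) → Eu d) =
      Matrix.vecCons v (i.removeNth w) := by
    ext j
    refine Fin.cases ?_ (fun j => ?_) j
    · simp [Fin.removeNth, Matrix.vecCons]
    · simp [Fin.removeNth, Matrix.vecCons]
  have h2 : ((0 : Fin (m + 2)).removeNth (Matrix.vecCons v w) : Fin (m + 1) → Eu d) = w := by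
    ext j
    simp [Fin.removeNth, Matrix.vecCons]
  simp only [h1, h2, Matrix.cons_val_zero, Matrix.cons_val_succ, Fin.val_succ, Fin.val_zero,
    pow_zero, one_smul, pow_succ, mul_neg, mul_one, neg_smul, Finset.sum_neg_distrib]
  rw [add_assoc, left_eq_add, neg_add_eq_zero]
  refine Finset.sum_congr rfl fun i _ => ?_
  simp

/-- By Cartan's formula, a current is controlled by its normal mass on derivatives of forms. -/
theorem abs_convForm_lineDeriv_le (T : NormalCurrents d m) (φ : TestFun d) (v : Eu d)
    (hv : ‖v‖ ≤ 1) (ψ : TestForm d m) (h1 : ∀ x, ‖ψ x‖ ≤ 1) (h2 : ∀ x, ‖extD ψ x‖ ≤ 1) :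
    |(T : Current d m) (convForm φ (∂_{v} ψ))| ≤ realNormalMass T * ∫ y, ‖φ y‖ := by
  -- The summand $\iota_v d\psi$ is paid for by $M(T)$. The other summand, $d\iota_v\psi$, is paid
  -- for by $M(\partial T)$ and is absent in degree zero.
  have hM := abs_le_of_mass _ (mass_ne_top T.2) _ _
    (norm_convForm_le φ _ 1 (norm_contract_le v hv _ 1 h2))
  rw [mul_one] at hM
  obtain _ | m := m
  · rw [lineDeriv_eq_contract_zero, realNormalMass_eq]
    simpa [bdMass] using hM
  · have hb := abs_le_of_bdMass T m rfl _ _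
      (norm_convForm_le φ _ 1 (norm_contract_le v hv _ 1 h1))
    rw [mul_one] at hb
    rw [lineDeriv_eq_contract_succ, realNormalMass_eq, map_add, map_add, add_mul,
      ← extD_convForm]
    exact (abs_add_le _ _).trans (add_le_add hM hb)

/-! ### The distance of a normal current to its mollification -/

theorem hasFDerivAt_of_quadratic_bound {E G : Type*} [NormedAddCommGroup E] [NormedSpace ℝ E]
    [NormedAddCommGroup G] [NormedSpace ℝ G] (f : E → G) (f' : E →L[ℝ] G) (x : E) (C : ℝ)
    (h : ∀ᶠ h in 𝓝 0, ‖f (x + h) - f x - f' h‖ ≤ C * ‖h‖ ^ 2) : HasFDerivAt f f' x := by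
  rw [hasFDerivAt_iff_isLittleO_nhds_zero]
  refine (Asymptotics.IsBigO.of_bound C ?_).trans_isLittleO
    (Asymptotics.isLittleO_norm_pow_id one_lt_two)
  filter_upwards [h] with h hh
  simpa using hh

/-- The product of a test function and a coordinate function. -/
def coordMul (i : Fin d) (φ : TestFun d) : TestFun d where
  toFun x := x i * φ x
  contDiff' := (EuclideanSpace.proj (𝕜 := ℝ) i).contDiff.mul φ.contDiff
  hasCompactSupport' := φ.hasCompactSupport.mul_left
  tsupport_subset' := by simp

theorem norm_single_one (i : Fin d) : ‖(EuclideanSpace.single i 1 : Eu d)‖ ≤ 1 := by simp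

theorem clm_apply_eq_sum {G : Type*} [NormedAddCommGroup G] [NormedSpace ℝ G] (A : Eu d →L[ℝ] G)
    (y : Eu d) : A y = ∑ i, y i • A (EuclideanSpace.single i 1) := by
  have h : y = ∑ i, y i • (EuclideanSpace.single i 1 : Eu d) := by
    have := (EuclideanSpace.basisFun (Fin d) ℝ).sum_repr y
    simpa using this.symm
  conv_lhs => rw [h]
  simp only [map_sum, map_smul]

theorem mollifier_norm_le {Φ : TestFun d} (hΦ : IsMollifier Φ) (y : Eu d) (h : Φ y ≠ 0) :
    ‖y‖ ≤ 1 := by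
  simpa using hΦ.tsupport_subset (subset_tsupport _ h)

theorem integral_norm_mollifier {Φ : TestFun d} (hΦ : IsMollifier Φ) : ∫ y, ‖Φ y‖ = 1 := by
  rw [← hΦ.integral_eq_one]
  exact integral_congr_ae (Eventually.of_forall fun y => Real.norm_of_nonneg (hΦ.nonneg y))

/-- The `t`-derivative of `Φ_t * ψ`, up to the sign. -/
def mollifyDeriv (Φ : TestFun d) (t : ℝ) (ht : 0 < t) (ψ : TestForm d m) : TestForm d m :=
  ∑ i, convForm (rescale (coordMul i Φ) t ht) (∂_{(EuclideanSpace.single i 1 : Eu d)} ψ)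

theorem integrable_dilate (φ : TestFun d) (ψ : TestForm d m) (t : ℝ) (x : Eu d) :
    Integrable (fun y => φ y • ψ (x - t • y)) (volume : Measure (Eu d)) :=
  ((φ.continuous.smul (ψ.continuous.comp (by fun_prop))).integrable_of_hasCompactSupport
    φ.hasCompactSupport.smul_right)

/-- The radial derivative is expanded in coordinates. The integral is what differentiation in `t`
produces, while the sum over constant directions is what Cartan's formula can be applied to. -/
theorem mollifyDeriv_apply (Φ : TestFun d) (t : ℝ) (ht : 0 < t) (ψ : TestForm d m) (x : Eu d) :
    mollifyDeriv Φ t ht ψ x = ∫ y, Φ y • fderiv ℝ ψ (x - t • y) y := by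
  have h1 : mollifyDeriv Φ t ht ψ x = ∑ i, convForm (rescale (coordMul i Φ) t ht)
      (∂_{(EuclideanSpace.single i 1 : Eu d)} ψ) x := sum_apply _ _ _
  rw [h1]
  simp only [convForm_rescale_apply]
  rw [← integral_finsetSum _ fun i _ => integrable_dilate _ _ _ _]
  refine integral_congr_ae (Eventually.of_forall fun y => ?_)
  simp only [lineDerivOp_testFunction_apply]
  rw [clm_apply_eq_sum (fderiv ℝ ψ (x - t • y)) y, Finset.smul_sum]
  refine Finset.sum_congr rfl fun i _ => ?_
  rw [smul_smul, mul_comm]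
  rfl

/-- Taylor's formula for `ψ` at `x - t • y` with increment `-(s - t) • y` is integrated against `Φ`,
on whose support `‖y‖ ≤ 1`. The bound is uniform in `x`, so it survives the application of a current
of finite mass. -/
theorem norm_mollify_taylor_le {Φ : TestFun d} (hΦ : IsMollifier Φ) (ψ : TestForm d m) (C : ℝ)
    (hC : ∀ x h : Eu d, ‖ψ (x + h) - ψ x - fderiv ℝ ψ x h‖ ≤ C * ‖h‖ ^ 2) (hC0 : 0 ≤ C)
    (s t : ℝ) (hs : 0 < s) (ht : 0 < t) (x : Eu d) :
    ‖convForm (rescale Φ s hs) ψ x - convForm (rescale Φ t ht) ψ x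
      + (s - t) • mollifyDeriv Φ t ht ψ x‖ ≤ C * (s - t) ^ 2 := by
  have hi : Integrable (fun y => Φ y • fderiv ℝ ψ (x - t • y) y) (volume : Measure (Eu d)) := by
    have hc : Continuous (fderiv ℝ ψ) := ψ.contDiff.continuous_fderiv (by simp)
    exact (Φ.continuous.smul ((hc.comp (by fun_prop : Continuous fun y : Eu d => x - t • y)).clm_apply
      continuous_id)).integrable_of_hasCompactSupport Φ.hasCompactSupport.smul_right
  have hi1 : Integrable (fun y => Φ y • ψ (x - s • y) - Φ y • ψ (x - t • y))
    (volume : Measure (Eu d)) := (integrable_dilate _ _ _ _).sub (integrable_dilate _ _ _ _)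
  have hi2 : Integrable (fun y => (s - t) • Φ y • fderiv ℝ ψ (x - t • y) y)
    (volume : Measure (Eu d)) := hi.smul (s - t)
  rw [convForm_rescale_apply, convForm_rescale_apply, mollifyDeriv_apply, ← integral_smul,
    ← integral_sub (integrable_dilate _ _ _ _) (integrable_dilate _ _ _ _),
    ← integral_add hi1 hi2,
    ← mul_one (C * (s - t) ^ 2), ← integral_norm_mollifier hΦ, ← integral_const_mul]
  refine norm_integral_le_of_norm_le ((integrable_testFun Φ).norm.const_mul _)
    (Eventually.of_forall fun y => ?_)
  have h1 := hC (x - t • y) (-(s - t) • y)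
  rw [show x - t • y + -(s - t) • y = x - s • y by module, map_smul,
    norm_smul _ y, norm_neg] at h1
  have e : Φ y • ψ (x - s • y) - Φ y • ψ (x - t • y) + (s - t) • Φ y • fderiv ℝ ψ (x - t • y) y =
      Φ y • (ψ (x - s • y) - ψ (x - t • y) - -(s - t) • fderiv ℝ ψ (x - t • y) y) := by
    module
  rw [e, norm_smul, mul_comm]
  by_cases hy : Φ y = 0
  · simp [hy]
  gcongr
  refine h1.trans (mul_le_mul_of_nonneg_left ?_ hC0)
  rw [mul_pow, Real.norm_eq_abs, sq_abs]
  exact mul_le_of_le_one_right (sq_nonneg _)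
    (pow_le_one₀ (norm_nonneg _) (mollifier_norm_le hΦ y hy))

theorem norm_mollify_sub_self_le {Φ : TestFun d} (hΦ : IsMollifier Φ) (ψ : TestForm d m) (C : ℝ)
    (hC : ∀ x y : Eu d, ‖ψ x - ψ y‖ ≤ C * ‖x - y‖) (hC0 : 0 ≤ C)
    (t : ℝ) (ht : 0 < t) (x : Eu d) :
    ‖ψ x - convForm (rescale Φ t ht) ψ x‖ ≤ C * t := by
  have h1 : ψ x = ∫ y, Φ y • ψ x := by
    rw [integral_smul_const, hΦ.integral_eq_one, one_smul]
  rw [h1, convForm_rescale_apply, ← integral_sub ((integrable_testFun Φ).smul_const _)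
    (integrable_dilate _ _ _ _), ← mul_one (C * t), ← integral_norm_mollifier hΦ,
    ← integral_const_mul]
  refine norm_integral_le_of_norm_le ((integrable_testFun Φ).norm.const_mul _)
    (Eventually.of_forall fun y => ?_)
  rw [← smul_sub, norm_smul, mul_comm]
  by_cases hy : Φ y = 0
  · simp [hy]
  gcongr
  refine (hC _ _).trans (mul_le_mul_of_nonneg_left ?_ hC0)
  rw [sub_sub_cancel, norm_smul, Real.norm_of_nonneg ht.le]
  exact mul_le_of_le_one_right ht.le (mollifier_norm_le hΦ y hy)

/-- The sum of the first moments of a test function. -/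
def momentSum (Φ : TestFun d) : ℝ := ∑ i, ∫ y, ‖coordMul i Φ y‖

theorem momentSum_nonneg (Φ : TestFun d) : 0 ≤ momentSum Φ :=
  Finset.sum_nonneg fun _ _ => integral_nonneg fun _ => norm_nonneg _

theorem abs_mollifyDeriv_le (T : NormalCurrents d m) (Φ : TestFun d) (t : ℝ) (ht : 0 < t)
    (ψ : TestForm d m) (h1 : ∀ x, ‖ψ x‖ ≤ 1) (h2 : ∀ x, ‖extD ψ x‖ ≤ 1) :
    |(T : Current d m) (mollifyDeriv Φ t ht ψ)| ≤ momentSum Φ * realNormalMass T := by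
  rw [mollifyDeriv, map_sum, momentSum, Finset.sum_mul]
  refine (Finset.abs_sum_le_sum_abs _ _).trans (Finset.sum_le_sum fun i _ => ?_)
  rw [mul_comm, ← integral_norm_rescale (coordMul i Φ) t ht]
  exact abs_convForm_lineDeriv_le T _ _ (norm_single_one i) ψ h1 h2

/-- Mean value inequality in the scale. The Taylor constant of `ψ` serves only to prove
differentiability and does not enter the final bound, which must be uniform over all forms admitted
in the flat norm. -/
theorem abs_mollify_sub_mollify_le {Φ : TestFun d} (hΦ : IsMollifier Φ) (T : NormalCurrents d m)
    (ψ : TestForm d m) (h1 : ∀ x, ‖ψ x‖ ≤ 1) (h2 : ∀ x, ‖extD ψ x‖ ≤ 1)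
    (s t : ℝ) (hs : 0 < s) (hst : s ≤ t) :
    |(T : Current d m) (convForm (rescale Φ t (hs.trans_le hst)) ψ) -
      (T : Current d m) (convForm (rescale Φ s hs) ψ)| ≤
      momentSum Φ * realNormalMass T * (t - s) := by
  obtain ⟨C, hC0, hC⟩ := exists_taylor_bound ψ (ψ.contDiff.of_le (WithTop.coe_le_coe.2 le_top))
    ψ.hasCompactSupport
  -- Rescaling needs a positive scale; the value zero elsewhere is never met on `[s, t]`.
  let f : ℝ → ℝ := fun r => if hr : 0 < r then (T : Current d m) (convForm (rescale Φ r hr) ψ) else 0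
  have hf (r : ℝ) (hr : 0 < r) : f r = (T : Current d m) (convForm (rescale Φ r hr) ψ) :=
    dif_pos hr
  have hd (r : ℝ) (hr : 0 < r) : HasDerivAt f (-(T : Current d m) (mollifyDeriv Φ r hr ψ)) r := by
    refine hasFDerivAt_of_quadratic_bound _ _ _ ((mass (T : Current d m)).toReal * C) ?_
    filter_upwards [Ioi_mem_nhds (neg_lt_zero.2 hr)] with h hh
    have hrh : 0 < r + h := by linarith [mem_Ioi.1 hh]
    rw [hf r hr, hf _ hrh]
    have key := abs_le_of_mass _ (mass_ne_top T.2)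
      (convForm (rescale Φ (r + h) hrh) ψ - convForm (rescale Φ r hr) ψ
        + h • mollifyDeriv Φ r hr ψ) (C * h ^ 2) fun x => by
          have := norm_mollify_taylor_le hΦ ψ C hC hC0 (r + h) r hrh hr x
          rwa [add_sub_cancel_left] at this
    rw [map_add, map_sub, map_smul, ← mul_assoc] at key
    simpa using key
  have := (convex_Icc s t).norm_image_sub_le_of_norm_hasDerivWithin_le (f := f)
    (C := momentSum Φ * realNormalMass T)
    (f' := fun r => if hr : 0 < r then -(T : Current d m) (mollifyDeriv Φ r hr ψ) else 0)
    (fun r hr => by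
      rw [dif_pos (hs.trans_le hr.1)]
      exact (hd r (hs.trans_le hr.1)).hasDerivWithinAt)
    (fun r hr => by
      rw [dif_pos (hs.trans_le hr.1), norm_neg]
      exact abs_mollifyDeriv_le T Φ r _ ψ h1 h2)
    (left_mem_Icc.2 hst) (right_mem_Icc.2 hst)
  rwa [hf t (hs.trans_le hst), hf s hs, Real.norm_eq_abs, Real.norm_of_nonneg (sub_nonneg.2 hst)]
    at this

/-- The flat distance of a normal current to its mollification. -/
theorem realFlatNorm_sub_mollify_le {Φ : TestFun d} (hΦ : IsMollifier Φ) (T : NormalCurrents d m)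
    (ε : ℝ) (hε : 0 < ε) : realFlatNorm (T - mollify T (rescale Φ ε hε)) ≤
      momentSum Φ * ε * realNormalMass T := by
  have hD : 0 ≤ momentSum Φ * realNormalMass T :=
    mul_nonneg (momentSum_nonneg Φ) (realNormalMass_nonneg T)
  rw [mul_right_comm]
  refine realFlatNorm_le _ _ (mul_nonneg hD hε.le) fun ψ h1 h2 => ?_
  obtain ⟨L, hL⟩ := (ψ.contDiff.of_le (by exact_mod_cast le_top) :
    ContDiff ℝ 1 ψ).lipschitzWith_of_hasCompactSupport ψ.hasCompactSupport one_ne_zero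
  have hL' (x y : Eu d) : ‖ψ x - ψ y‖ ≤ L * ‖x - y‖ := by
    rw [← dist_eq_norm, ← dist_eq_norm]
    exact hL.dist_le_mul x y
  -- Scale zero is reached as a limit: the error between `ψ` and `Φ_s * ψ` involves the Lipschitz
  -- constant `L` of `ψ`, but it vanishes as `s → 0`, so `L` disappears.
  have hlim : Tendsto (fun s : ℝ => (mass (T : Current d m)).toReal * (L * s) +
      momentSum Φ * realNormalMass T * ε) (𝓝[>] 0)
      (𝓝 ((mass (T : Current d m)).toReal * (L * 0) + momentSum Φ * realNormalMass T * ε)) :=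
    (Continuous.tendsto (by fun_prop) _).mono_left nhdsWithin_le_nhds
  rw [mul_zero, mul_zero, zero_add] at hlim
  refine ge_of_tendsto hlim ?_
  filter_upwards [Ioc_mem_nhdsGT hε] with s hs
  have e1 := abs_le_of_mass _ (mass_ne_top T.2) (ψ - convForm (rescale Φ s hs.1) ψ) (L * s)
    fun x => norm_mollify_sub_self_le hΦ ψ L hL' L.2 s hs.1 x
  have e2 := abs_mollify_sub_mollify_le hΦ T ψ h1 h2 s ε hs.1 hs.2
  have e3 : momentSum Φ * realNormalMass T * (ε - s) ≤ momentSum Φ * realNormalMass T * ε :=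
    mul_le_mul_of_nonneg_left (by linarith [hs.1]) hD
  have e4 : ((T - mollify T (rescale Φ ε hε) : NormalCurrents d m) : Current d m) ψ =
      (T : Current d m) ψ - (T : Current d m) (convForm (rescale Φ ε hε) ψ) := by
    rw [← mollify_apply]
    rfl
  rw [map_sub] at e1
  rw [e4]
  linarith [le_abs_self ((T : Current d m) ψ - (T : Current d m) (convForm (rescale Φ s hs.1) ψ)),
    neg_abs_le ((T : Current d m) (convForm (rescale Φ ε hε) ψ) -
      (T : Current d m) (convForm (rescale Φ s hs.1) ψ))]

/-! ### Mollification of fractional charges -/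

theorem integral_norm_rescale_mollifier {Φ : TestFun d} (hΦ : IsMollifier Φ) (ε : ℝ)
    (hε : 0 < ε) : ∫ y, ‖rescale Φ ε hε y‖ ≤ 1 := by
  rw [integral_norm_rescale, integral_norm_mollifier hΦ]

theorem tsupport_reflect_rescale_subset {Φ : TestFun d} (hΦ : IsMollifier Φ) (ε : ℝ)
    (hε : 0 < ε) : tsupport (reflect (rescale Φ ε hε)) ⊆ Metric.closedBall 0 ε := by
  refine closure_minimal (fun x hx => ?_) Metric.isClosed_closedBall
  have h1 : (ε ^ d)⁻¹ * Φ (ε⁻¹ • -x) ≠ 0 := hx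
  have h2 := mollifier_norm_le hΦ _ (right_ne_zero_of_mul h1)
  rw [norm_smul, norm_neg, norm_inv, Real.norm_of_nonneg hε.le, inv_mul_le_iff₀ hε,
    mul_one] at h2
  simpa using h2

theorem spt_mollify_rescale_subset {Φ : TestFun d} (hΦ : IsMollifier Φ) (ε : ℝ) (hε : 0 < ε)
    (T : NormalCurrents d m) {K : Set (Eu d)} (hT : spt (T : Current d m) ⊆ K) :
    spt (mollify T (rescale Φ ε hε) : Current d m) ⊆ Metric.cthickening ε K := by
  refine (spt_mollify_subset T _).trans ((add_subset_add_left
    (tsupport_reflect_rescale_subset hΦ ε hε)).trans ?_)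
  rw [T.2.1.add_closedBall_zero hε.le]
  exact Metric.cthickening_subset_of_subset ε hT

theorem normalMass_sub_le (S T : Current d m) :
    normalMass (S - T) ≤ normalMass S + normalMass T := by
  have h1 := mass_add_le S ((-1 : ℝ) • T)
  have h2 := bdMass_add_le S ((-1 : ℝ) • T)
  have h3 := mass_smul_le (-1) T
  have h4 := bdMass_smul_le (-1) T
  simp only [abs_neg, abs_one, ENNReal.ofReal_one, one_mul] at h3 h4
  rw [sub_eq_add_neg, ← neg_one_smul ℝ T]
  unfold normalMass
  calc _ ≤ (mass S + mass T) + (bdMass S + bdMass T) :=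
        add_le_add (h1.trans (by gcongr)) (h2.trans (by gcongr))
    _ = _ := by ring

theorem realNormalMass_sub_le (S T : NormalCurrents d m) :
    realNormalMass (S - T) ≤ realNormalMass S + realNormalMass T := by
  unfold realNormalMass
  rw [← ENNReal.toReal_add S.2.2 T.2.2]
  exact ENNReal.toReal_mono (ENNReal.add_ne_top.2 ⟨S.2.2, T.2.2⟩)
    (normalMass_sub_le (S : Current d m) T)

theorem FracBound.abs_le {α : ℝ} {K : Set (Eu d)} {ω : Functional d m} {C : ℝ≥0}
    (h : FracBound α K ω C) (h0 : 0 < α) (h1 : α ≤ 1) (T : NormalCurrents d m)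
    (hT : spt (T : Current d m) ⊆ K) (a b : ℝ) (ha : realNormalMass T ≤ a)
    (hb : realFlatNorm T ≤ b) : |ω T| ≤ C * a ^ (1 - α) * b ^ α := by
  have hN := realNormalMass_nonneg T
  have hF := realFlatNorm_nonneg T
  have ha0 := hN.trans ha
  refine (h T hT).trans ?_
  change C * realNormalMass T ^ (1 - α) * realFlatNorm T ^ α ≤ _
  gcongr

theorem FracBound.abs_le_realNormalMass {α : ℝ} {K : Set (Eu d)} {ω : Functional d m} {C : ℝ≥0}
    (h : FracBound α K ω C) (h0 : 0 < α) (h1 : α ≤ 1) (T : NormalCurrents d m)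
    (hT : spt (T : Current d m) ⊆ K) : |ω T| ≤ C * realNormalMass T := by
  refine (h.abs_le h0 h1 T hT _ _ le_rfl (realFlatNorm_le_realNormalMass T)).trans_eq ?_
  rw [mul_assoc, ← Real.rpow_add_of_nonneg (realNormalMass_nonneg T) (by linarith) h0.le,
    sub_add_cancel, Real.rpow_one]

theorem FracBound.chargeConv {Φ : TestFun d} (hΦ : IsMollifier Φ) {ε : ℝ} (hε : 0 < ε)
    {α : ℝ} (h0 : 0 < α) (h1 : α ≤ 1) {K : Set (Eu d)} {ω : Functional d m} {C : ℝ≥0}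
    (h : FracBound α (Metric.cthickening ε K) ω C) :
    FracBound α K (chargeConv ω (rescale Φ ε hε)) C := fun T hT =>
  h.abs_le h0 h1 _ (spt_mollify_rescale_subset hΦ ε hε T hT) _ _
    (realNormalMass_mollify_le T _ (integral_norm_rescale_mollifier hΦ ε hε))
    (realFlatNorm_mollify_le T _ (integral_norm_rescale_mollifier hΦ ε hε))

/-- The constant in the estimates for the mollification. -/
def mollifyConst (m : ℕ) (Φ : TestFun d) : ℝ≥0 :=
  ⟨2 * (1 + (m + 1) * gradInt Φ + momentSum Φ), by
    have := gradInt_nonneg Φ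
    have := momentSum_nonneg Φ
    positivity⟩

theorem two_le_mollifyConst (m : ℕ) (Φ : TestFun d) : 2 ≤ (mollifyConst m Φ : ℝ) := by
  have h1 : 0 ≤ (m + 1) * gradInt Φ := mul_nonneg (by positivity) (gradInt_nonneg Φ)
  have h2 := momentSum_nonneg Φ
  change 2 ≤ 2 * (1 + (m + 1) * gradInt Φ + momentSum Φ)
  linarith

theorem rpow_le_self_of_one_le {x a : ℝ} (hx : 1 ≤ x) (ha : a ≤ 1) : x ^ a ≤ x := by
  simpa using Real.rpow_le_rpow_of_exponent_le hx ha

/-- Inserting $N(T_{\Phi_\varepsilon})\le C\varepsilon^{-1}F(T)$ and $F(T_{\Phi_\varepsilon})\le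
F(T)$ turns $N^{1-\alpha}F^\alpha$ into $(C\varepsilon^{-1})^{1-\alpha}F(T)$. -/
theorem FracBound.chargeConv_one {Φ : TestFun d} (hΦ : IsMollifier Φ) {ε : ℝ} (hε : 0 < ε)
    (hε1 : ε ≤ 1) {α : ℝ} (h0 : 0 < α) (h1 : α ≤ 1) {K : Set (Eu d)} {ω : Functional d m}
    {C : ℝ≥0} (h : FracBound α (Metric.cthickening ε K) ω C) :
    FracBound 1 K (FracCharge.chargeConv ω (rescale Φ ε hε))
      (mollifyConst m Φ * (ε ^ (α - 1)).toNNReal * C) := by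
  intro T hT
  have hF := realFlatNorm_nonneg T
  have hB := two_le_mollifyConst m Φ
  have hg : 0 ≤ (m + 1) * gradInt Φ := mul_nonneg (by positivity) (gradInt_nonneg Φ)
  have hN : realNormalMass (mollify T (rescale Φ ε hε)) ≤
      mollifyConst m Φ * ε⁻¹ * realFlatNorm T := by
    refine (realNormalMass_mollify_le_realFlatNorm T _ (integral_norm_rescale_mollifier hΦ ε hε)
      ((1 + (m + 1) * gradInt Φ) * ε⁻¹) ?_ ?_).trans ?_
    -- The factor must be at least one to dominate the comass of `φ * ψ` as well; this is where `ε ≤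
    -- 1` enters.
    · exact one_le_mul_of_one_le_of_one_le (by linarith) ((one_le_inv₀ hε).2 hε1)
    · rw [gradInt_rescale, mul_left_comm, mul_comm]
      gcongr
      linarith
    · rw [← mul_assoc]
      gcongr
      change _ ≤ 2 * (1 + (m + 1) * gradInt Φ + momentSum Φ)
      linarith [momentSum_nonneg Φ]
  refine (h.abs_le h0 h1 _ (spt_mollify_rescale_subset hΦ ε hε T hT) _ _ hN
    (realFlatNorm_mollify_le T _ (integral_norm_rescale_mollifier hΦ ε hε))).trans ?_
  change _ ≤ ((mollifyConst m Φ * (ε ^ (α - 1)).toNNReal * C : ℝ≥0) : ℝ) *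
    realNormalMass T ^ ((1 : ℝ) - 1) * realFlatNorm T ^ (1 : ℝ)
  have e1 : realFlatNorm T ^ (1 - α) * realFlatNorm T ^ α = realFlatNorm T := by
    rw [← Real.rpow_add_of_nonneg hF (by linarith) h0.le, sub_add_cancel, Real.rpow_one]
  have e2 : ε⁻¹ ^ (1 - α) = ε ^ (α - 1) := by
    rw [Real.inv_rpow hε.le, ← Real.rpow_neg hε.le, neg_sub]
  have e3 := Real.rpow_nonneg hε.le (α - 1)
  rw [Real.mul_rpow (by positivity) hF, Real.mul_rpow (by positivity) (by positivity), e2,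
    NNReal.coe_mul, NNReal.coe_mul, Real.coe_toNNReal _ e3, sub_self, Real.rpow_zero, mul_one,
    Real.rpow_one]
  calc (C : ℝ) * ((mollifyConst m Φ : ℝ) ^ (1 - α) * ε ^ (α - 1) * realFlatNorm T ^ (1 - α)) *
        realFlatNorm T ^ α
      = C * (mollifyConst m Φ : ℝ) ^ (1 - α) * ε ^ (α - 1) *
        (realFlatNorm T ^ (1 - α) * realFlatNorm T ^ α) := by ring
    _ = C * (mollifyConst m Φ : ℝ) ^ (1 - α) * ε ^ (α - 1) * realFlatNorm T := by rw [e1]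
    -- Since the constant is at least one, its power `1 - α` is at most the constant itself, which
    -- makes the bound independent of `α`.
    _ ≤ C * (mollifyConst m Φ : ℝ) * ε ^ (α - 1) * realFlatNorm T := by
        gcongr
        exact rpow_le_self_of_one_le (by linarith) (by linarith)
    _ = _ := by ring

theorem FracBound.chargeNorm_sub_le {Φ : TestFun d} (hΦ : IsMollifier Φ) {ε : ℝ} (hε : 0 < ε)
    {α : ℝ} (h0 : 0 < α) (h1 : α ≤ 1) {K : Set (Eu d)}
    {ω : Functional d m} {C : ℝ≥0} (h : FracBound α (Metric.cthickening ε K) ω C) :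
    chargeNorm K (ω - FracCharge.chargeConv ω (rescale Φ ε hε)) ≤
      ((mollifyConst m Φ * (ε ^ α).toNNReal : ℝ≥0) : ℝ≥0∞) * C := by
  refine iSup₂_le fun T hT => ?_
  have hN0 := realNormalMass_nonneg T
  have hN1 : realNormalMass T ≤ 1 :=
    realNormalMass_le T 1 zero_le_one (hT.2.trans_eq ENNReal.ofReal_one.symm)
  have hD := momentSum_nonneg Φ
  have hN : realNormalMass (T - mollify T (rescale Φ ε hε)) ≤ 2 := by
    have e1 := realNormalMass_sub_le T (mollify T (rescale Φ ε hε))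
    have e2 := realNormalMass_mollify_le T _ (integral_norm_rescale_mollifier hΦ ε hε)
    linarith
  -- The added one makes the base at least one, so that its power `α` can later be replaced by the
  -- base.
  have hF : realFlatNorm (T - mollify T (rescale Φ ε hε)) ≤ (1 + momentSum Φ) * ε := by
    refine (realFlatNorm_sub_mollify_le hΦ T ε hε).trans ?_
    refine (mul_le_of_le_one_right (by positivity) hN1).trans ?_
    gcongr
    linarith
  have hs : spt ((T - mollify T (rescale Φ ε hε) : NormalCurrents d m) : Current d m) ⊆
      Metric.cthickening ε K :=
    spt_sub_subset (hT.1.trans (Metric.self_subset_cthickening K))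
      (spt_mollify_rescale_subset hΦ ε hε T hT.1)
  have key := h.abs_le h0 h1 _ hs _ _ hN hF
  have e3 := Real.rpow_nonneg hε.le α
  rw [← ENNReal.coe_mul]
  refine ENNReal.ofReal_le_of_le_toReal ?_
  rw [ENNReal.coe_toReal, NNReal.coe_mul, NNReal.coe_mul, Real.coe_toNNReal _ e3]
  have e4 : (ω - FracCharge.chargeConv ω (rescale Φ ε hε)) T =
      ω (T - mollify T (rescale Φ ε hε)) := by
    exact (LinearMap.map_sub ω T (mollify T (rescale Φ ε hε))).symm
  rw [e4]
  refine (le_abs_self _).trans (key.trans ?_)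
  rw [Real.mul_rpow (by positivity) hε.le]
  calc (C : ℝ) * 2 ^ (1 - α) * ((1 + momentSum Φ) ^ α * ε ^ α)
      ≤ C * 2 * ((1 + momentSum Φ) * ε ^ α) := by
        gcongr
        · exact rpow_le_self_of_one_le (by norm_num) (by linarith)
        · exact rpow_le_self_of_one_le (by linarith) h1
    _ = 2 * (1 + momentSum Φ) * ε ^ α * C := by ring
    _ ≤ (mollifyConst m Φ : ℝ) * ε ^ α * C := by
        gcongr
        change _ ≤ 2 * (1 + (m + 1) * gradInt Φ + momentSum Φ)
        have : 0 ≤ (m + 1) * gradInt Φ := mul_nonneg (by positivity) (gradInt_nonneg Φ)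
        linarith

/-- The set of admissible constants may be empty and the infimum infinite; `a ≠ 0` excludes the
product `0 * ⊤ = 0`, for which the conclusion could fail. -/
theorem le_mul_fracNorm {α : ℝ} {K : Set (Eu d)} {ω : Functional d m} (a : ℝ≥0) (ha : a ≠ 0)
    (X : ℝ≥0∞) (h : ∀ C : ℝ≥0, FracBound α K ω C → X ≤ a * C) : X ≤ a * fracNorm α K ω := by
  have ha' : (a : ℝ≥0∞) ≠ 0 := ENNReal.coe_ne_zero.2 ha
  rw [fracNorm, ENNReal.mul_iInf_of_ne ha' ENNReal.coe_ne_top]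
  refine le_iInf fun C => ?_
  rw [ENNReal.mul_iInf_of_ne ha' ENNReal.coe_ne_top]
  exact le_iInf fun hC => h C hC

theorem fracNorm_le_of_fracBound {α : ℝ} {K : Set (Eu d)} {ω : Functional d m} {C : ℝ≥0}
    (h : FracBound α K ω C) : fracNorm α K ω ≤ C := iInf₂_le C h

theorem fracNorm_mono {α : ℝ} {K L : Set (Eu d)} (hKL : K ⊆ L) (ω : Functional d m) :
    fracNorm α K ω ≤ fracNorm α L ω :=
  le_iInf₂ fun _ hC => fracNorm_le_of_fracBound fun T hT => hC T (hT.trans hKL)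

theorem mollifyConst_mul_ne_zero (m : ℕ) (Φ : TestFun d) {x : ℝ} (hx : 0 < x) :
    mollifyConst m Φ * x.toNNReal ≠ 0 := by
  refine mul_ne_zero (fun h => ?_) (by simpa using hx)
  have := two_le_mollifyConst m Φ
  rw [h, NNReal.coe_zero] at this
  linarith

theorem fracNorm_chargeConv_le {Φ : TestFun d} (hΦ : IsMollifier Φ) {ε : ℝ} (hε : 0 < ε)
    {α : ℝ} (h0 : 0 < α) (h1 : α ≤ 1) (K : Set (Eu d)) (ω : Functional d m) :
    fracNorm α K (chargeConv ω (rescale Φ ε hε)) ≤ fracNorm α (Metric.cthickening ε K) ω :=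
  le_iInf₂ fun _ hC => fracNorm_le_of_fracBound (hC.chargeConv hΦ hε h0 h1)

theorem fracNorm_one_chargeConv_le {Φ : TestFun d} (hΦ : IsMollifier Φ) {ε : ℝ} (hε : 0 < ε)
    (hε1 : ε ≤ 1) {α : ℝ} (h0 : 0 < α) (h1 : α ≤ 1) (K : Set (Eu d)) (ω : Functional d m) :
    fracNorm 1 K (chargeConv ω (rescale Φ ε hε)) ≤
      mollifyConst m Φ * ENNReal.ofReal (ε ^ (α - 1)) *
        fracNorm α (Metric.cthickening ε K) ω := by
  rw [ENNReal.ofReal, ← ENNReal.coe_mul]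
  refine le_mul_fracNorm _ (mollifyConst_mul_ne_zero m Φ (Real.rpow_pos_of_pos hε _)) _
    fun C hC => ?_
  rw [← ENNReal.coe_mul]
  exact fracNorm_le_of_fracBound (hC.chargeConv_one hΦ hε hε1 h0 h1)

theorem chargeNorm_sub_chargeConv_le {Φ : TestFun d} (hΦ : IsMollifier Φ) {ε : ℝ} (hε : 0 < ε)
    {α : ℝ} (h0 : 0 < α) (h1 : α ≤ 1) (K : Set (Eu d)) (ω : Functional d m) :
    chargeNorm K (ω - chargeConv ω (rescale Φ ε hε)) ≤
      mollifyConst m Φ * ENNReal.ofReal (ε ^ α) * fracNorm α (Metric.cthickening ε K) ω := by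
  rw [ENNReal.ofReal, ← ENNReal.coe_mul]
  exact le_mul_fracNorm _ (mollifyConst_mul_ne_zero m Φ (Real.rpow_pos_of_pos hε _)) _
    fun C hC => hC.chargeNorm_sub_le hΦ hε h0 h1

theorem chargeNorm_sub_comm_le (K : Set (Eu d)) (ω ω' : Functional d m) :
    chargeNorm K (ω - ω') ≤ chargeNorm K (ω' - ω) := by
  refine iSup₂_le fun T hT => le_iSup₂_of_le (-T) ⟨?_, ?_⟩ ?_
  · have := spt_sub_subset (S := (0 : Current d m)) (by simp [spt_zero]) hT.1
    rwa [zero_sub] at this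
  · have h := normalMass_sub_le 0 (T : Current d m)
    have h0 : normalMass (0 : Current d m) = 0 := by
      have := (mass_smul_le 0 (0 : Current d m))
      have h' := (bdMass_smul_le 0 (0 : Current d m))
      simp only [smul_zero, abs_zero, ENNReal.ofReal_zero, zero_mul, nonpos_iff_eq_zero] at this h'
      simp [normalMass, this, h']
    rw [zero_sub, h0, zero_add] at h
    exact h.trans hT.2
  · have e1 : ω (-T) = -ω T := map_neg ω T
    have e2 : ω' (-T) = -ω' T := map_neg ω' T
    rw [LinearMap.sub_apply, LinearMap.sub_apply, e1, e2]
    exact ENNReal.ofReal_le_ofReal (by linarith)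

theorem IsFracCharge.chargeConv {Φ : TestFun d} (hΦ : IsMollifier Φ) {ε : ℝ} (hε : 0 < ε)
    {α : ℝ} (h0 : 0 < α) (h1 : α ≤ 1) {ω : Functional d m} (hω : IsFracCharge α ω) :
    IsFracCharge α (chargeConv ω (rescale Φ ε hε)) := by
  have hφ := integral_norm_rescale_mollifier hΦ ε hε
  refine ⟨fun K hK T hT ⟨c, hc⟩ hF => ?_, fun K hK => ?_⟩
  · refine hω.1 _ hK.cthickening (fun n => mollify (T n) (rescale Φ ε hε))
      (fun n => spt_mollify_rescale_subset hΦ ε hε (T n) (hT n)) ⟨c, fun n => ?_⟩ ?_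
    · exact ((ENNReal.toReal_le_toReal (mollify (T n) _).2.2 (T n).2.2).1
        (realNormalMass_mollify_le (T n) _ hφ)).trans (hc n)
    · refine tendsto_of_tendsto_of_tendsto_of_le_of_le tendsto_const_nhds hF
        (fun n => zero_le) fun n => ?_
      exact (ENNReal.toReal_le_toReal (flatNorm_ne_top _) (flatNorm_ne_top (T n))).1
        (realFlatNorm_mollify_le (T n) _ hφ)
  · obtain ⟨C, hC⟩ := hω.2 _ (hK.cthickening (r := ε))
    exact ⟨C, hC.chargeConv hΦ hε h0 h1⟩

theorem IsFracCharge.weakStarTendsto_chargeConv {Φ : TestFun d} (hΦ : IsMollifier Φ) {α : ℝ}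
    (h0 : 0 < α) (h1 : α ≤ 1) {ω : Functional d m} (hω : IsFracCharge α ω) (ε : ℕ → ℝ)
    (hε : ∀ n, 0 < ε n) (hε1 : ∀ n, ε n ≤ 1) (hlim : Tendsto ε atTop (𝓝 0)) :
    WeakStarTendsto α (fun n => FracCharge.chargeConv ω (rescale Φ (ε n) (hε n))) ω := by
  refine ⟨fun n => hω.chargeConv hΦ (hε n) h0 h1, hω, fun K hK => ?_⟩
  -- All scales are at most one, so a single neighbourhood of `K` serves the whole sequence.
  obtain ⟨C, hC⟩ := hω.2 _ (hK.cthickening (r := 1))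
  have hfin : fracNorm α (Metric.cthickening 1 K) ω < ⊤ :=
    (fracNorm_le_of_fracBound hC).trans_lt ENNReal.coe_lt_top
  have hmono (n : ℕ) : fracNorm α (Metric.cthickening (ε n) K) ω ≤
      fracNorm α (Metric.cthickening 1 K) ω :=
    fracNorm_mono (Metric.cthickening_mono (hε1 n) K) ω
  refine ⟨(iSup_le fun n => (fracNorm_chargeConv_le hΦ (hε n) h0 h1 K ω).trans
    (hmono n)).trans_lt hfin, ?_⟩
  have hpow : Tendsto (fun n => ENNReal.ofReal (ε n ^ α)) atTop (𝓝 0) := by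
    have := hlim.rpow_const (p := α) (Or.inr h0.le)
    rw [Real.zero_rpow h0.ne'] at this
    simpa using ENNReal.tendsto_ofReal this
  have hbd := ENNReal.Tendsto.mul_const
    (ENNReal.Tendsto.const_mul hpow (Or.inr (ENNReal.coe_ne_top (r := mollifyConst m Φ))))
    (Or.inr hfin.ne)
  rw [mul_zero, zero_mul] at hbd
  refine tendsto_of_tendsto_of_tendsto_of_le_of_le tendsto_const_nhds hbd
    (fun n => zero_le) fun n => ?_
  refine (chargeNorm_sub_comm_le K _ _).trans
    ((chargeNorm_sub_chargeConv_le hΦ (hε n) h0 h1 K ω).trans ?_)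
  gcongr
  exact hmono n

/-! ### Smeared point evaluations -/

/-- The derivative of a test function in the direction of a coordinate vector. -/
def partialD (i : Fin d) (φ : TestFun d) : TestFun d := ∂_{(EuclideanSpace.single i 1 : Eu d)} φ

theorem fderiv_convForm_single (φ : TestFun d) (ψ : TestForm d m) (x : Eu d) (i : Fin d) :
    fderiv ℝ (convForm φ ψ) x (EuclideanSpace.single i 1) = convForm (partialD i φ) ψ x :=
  fderiv_convForm_apply φ ψ x _

theorem fderiv_convForm_eq_sum (φ : TestFun d) (ψ : TestForm d m) (x v : Eu d) :
    fderiv ℝ (convForm φ ψ) x v = ∑ i, v i • convForm (partialD i φ) ψ x := by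
  rw [clm_apply_eq_sum]
  simp only [fderiv_convForm_single]

theorem abs_coord_le (v : Eu d) (i : Fin d) : |v i| ≤ ‖v‖ := PiLp.norm_apply_le v i

/-- A bound for the Lipschitz constant of the gradient of a convolution. -/
def hessInt (φ : TestFun d) : ℝ := ∑ i, gradInt (partialD i φ)

theorem hessInt_nonneg (φ : TestFun d) : 0 ≤ hessInt φ :=
  Finset.sum_nonneg fun _ _ => gradInt_nonneg _

/-- Each partial derivative of `φ * ψ` is a convolution with `∂ᵢφ`, hence Lipschitz with a constant
depending on `ψ` only through its supremum. -/
theorem norm_fderiv_convForm_sub_le (φ : TestFun d) (ψ : TestForm d m) (R : ℝ)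
    (hR : ∀ x, ‖ψ x‖ ≤ R) (x z : Eu d) :
    ‖fderiv ℝ (convForm φ ψ) z - fderiv ℝ (convForm φ ψ) x‖ ≤ hessInt φ * R * ‖z - x‖ := by
  have hR0 : 0 ≤ R := (norm_nonneg _).trans (hR 0)
  refine ContinuousLinearMap.opNorm_le_bound _
    (mul_nonneg (mul_nonneg (hessInt_nonneg φ) hR0) (norm_nonneg _)) fun v => ?_
  rw [sub_apply, fderiv_convForm_eq_sum, fderiv_convForm_eq_sum,
    ← Finset.sum_sub_distrib, hessInt, Finset.sum_mul, Finset.sum_mul, Finset.sum_mul]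
  refine (norm_sum_le _ _).trans (Finset.sum_le_sum fun i _ => ?_)
  have e : v i • convForm (partialD i φ) ψ z - v i • convForm (partialD i φ) ψ x =
      v i • (convForm (partialD i φ) ψ z - convForm (partialD i φ) ψ x) := by module
  rw [e, norm_smul, mul_comm]
  have := gradInt_nonneg (partialD i φ)
  exact mul_le_mul (norm_convForm_sub_le _ ψ R hR z x) (abs_coord_le v i) (norm_nonneg _)
    (by positivity)

/-- The remainder in the first order Taylor expansion of a convolution. -/
def convRem (φ : TestFun d) (ψ : TestForm d m) (x h : Eu d) : Covector d m :=
  convForm φ ψ (x + h) - convForm φ ψ x - fderiv ℝ (convForm φ ψ) x h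

theorem norm_convRem_le (φ : TestFun d) (ψ : TestForm d m) (R : ℝ)
    (hR : ∀ x, ‖ψ x‖ ≤ R) (x h : Eu d) : ‖convRem φ ψ x h‖ ≤ hessInt φ * R * ‖h‖ ^ 2 :=
  norm_taylor_le_of_lipschitz _ (differentiable_testFunction _) _
    (mul_nonneg (hessInt_nonneg φ) ((norm_nonneg _).trans (hR 0)))
    (norm_fderiv_convForm_sub_le φ ψ R hR) x h

/-- The exterior product with a coordinate covector, as it occurs in the exterior derivative. -/
def coordWedge (i : Fin d) : Covector d m →L[ℝ] Covector d (m + 1) :=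
  (ContinuousAlternatingMap.alternatizeUncurryFinCLM ℝ (Eu d) ℝ).comp
    (ContinuousLinearMap.smulRightL ℝ (Eu d) (Covector d m) (EuclideanSpace.proj (𝕜 := ℝ) i))

theorem norm_coordWedge_le (i : Fin d) (c : Covector d m) :
    ‖coordWedge i c‖ ≤ (m + 1) * ‖c‖ := by
  refine (ContinuousAlternatingMap.norm_alternatizeUncurryFin_le _).trans ?_
  gcongr
  refine ContinuousLinearMap.opNorm_le_bound _ (norm_nonneg _) fun v => ?_
  change ‖v i • c‖ ≤ _
  rw [norm_smul, mul_comm]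
  gcongr
  exact abs_coord_le v i

theorem convForm_extD_eq_sum (φ : TestFun d) (ψ : TestForm d m) (x : Eu d) :
    convForm φ (extD ψ) x =
      ∑ i, coordWedge i (convForm φ (∂_{(EuclideanSpace.single i 1 : Eu d)} ψ) x) := by
  rw [← extD_convForm, extD_apply, extDeriv]
  have h : fderiv ℝ (convForm φ ψ) x = ∑ i, ContinuousLinearMap.smulRightL ℝ (Eu d)
      (Covector d m) (EuclideanSpace.proj (𝕜 := ℝ) i)
        (convForm φ (∂_{(EuclideanSpace.single i 1 : Eu d)} ψ) x) := by
    ext1 v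
    rw [clm_apply_eq_sum, sum_apply]
    refine Finset.sum_congr rfl fun i _ => ?_
    rw [fderiv_convForm_apply_right]
    rfl
  rw [h, ← ContinuousAlternatingMap.alternatizeUncurryFinCLM_apply, map_sum]
  rfl

/-- Integration by parts: both sides are the `i`-th partial derivative of `φ * ψ`. -/
theorem convForm_lineDeriv (φ : TestFun d) (ψ : TestForm d m) (i : Fin d) :
    convForm φ (∂_{(EuclideanSpace.single i 1 : Eu d)} ψ) = convForm (partialD i φ) ψ := by
  ext1 x
  rw [← fderiv_convForm_single, fderiv_convForm_apply_right]

theorem convRem_eq_sum (φ : TestFun d) (ψ : TestForm d m) (x h : Eu d) :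
    convRem φ ψ x h = convForm φ ψ (x + h) - convForm φ ψ x -
      ∑ i, h i • convForm (partialD i φ) ψ x := by
  rw [convRem, fderiv_convForm_eq_sum]

/-- Writing $d=\sum_i dx_i\wedge\partial_i$ and moving $\partial_i$ onto the kernel leaves Taylor
remainders of convolutions with `ψ` itself. The boundary of the remainder current can thus be
bounded by the supremum of `ψ`, without control of `dψ`. -/
theorem convRem_extD (φ : TestFun d) (ψ : TestForm d m) (x h : Eu d) :
    convRem φ (extD ψ) x h = ∑ i, coordWedge i (convRem (partialD i φ) ψ x h) := by
  have e (i : Fin d) : convRem (partialD i φ) ψ x h =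
      convForm φ (∂_{(EuclideanSpace.single i 1 : Eu d)} ψ) (x + h) -
      convForm φ (∂_{(EuclideanSpace.single i 1 : Eu d)} ψ) x -
      ∑ j, h j • convForm (partialD j φ) (∂_{(EuclideanSpace.single i 1 : Eu d)} ψ) x := by
    rw [convRem, ← convForm_lineDeriv, fderiv_convForm_eq_sum]
  rw [convRem_eq_sum]
  simp only [e, map_sub, map_sum, map_smul, convForm_extD_eq_sum, Finset.sum_sub_distrib,
    Finset.smul_sum]
  rw [Finset.sum_comm]

theorem norm_convRem_extD_le (φ : TestFun d) (ψ : TestForm d m) (R : ℝ)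
    (hR : ∀ x, ‖ψ x‖ ≤ R) (x h : Eu d) : ‖convRem φ (extD ψ) x h‖ ≤
      (m + 1) * (∑ i, hessInt (partialD i φ)) * R * ‖h‖ ^ 2 := by
  rw [convRem_extD, Finset.mul_sum, Finset.sum_mul, Finset.sum_mul]
  refine (norm_sum_le _ _).trans (Finset.sum_le_sum fun i _ => ?_)
  refine (norm_coordWedge_le _ _).trans ?_
  rw [mul_assoc, mul_assoc, ← mul_assoc (hessInt _)]
  gcongr
  exact norm_convRem_le _ _ R hR x h

theorem neg_mem_tsupport_reflect {φ : TestFun d} {y : Eu d} (hy : y ∈ tsupport φ) :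
    -y ∈ tsupport (reflect φ) := by
  have h := tsupport_comp_subset_preimage (reflect φ : Eu d → ℝ) (f := fun x => -x) continuous_neg
  have e : ((reflect φ : Eu d → ℝ) ∘ fun x => -x) = φ := congrArg DFunLike.coe (reflect_reflect φ)
  rw [e] at h
  exact h hy

theorem exists_dual_bound (l : Covector d m →ₗ[ℝ] ℝ) :
    ∃ b : ℝ, 0 < b ∧ ∀ c, |l c| ≤ b * ‖c‖ := l.toContinuousLinearMap.bound

/-- A bound for a functional on covectors. -/
def dualBound (l : Covector d m →ₗ[ℝ] ℝ) : ℝ := (exists_dual_bound l).choose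

theorem dualBound_nonneg (l : Covector d m →ₗ[ℝ] ℝ) : 0 ≤ dualBound l :=
  (exists_dual_bound l).choose_spec.1.le

theorem abs_le_dualBound (l : Covector d m →ₗ[ℝ] ℝ) {c : Covector d m} {R : ℝ} (hc : ‖c‖ ≤ R) :
    |l c| ≤ dualBound l * R :=
  ((exists_dual_bound l).choose_spec.2 c).trans
    (mul_le_mul_of_nonneg_left hc (dualBound_nonneg l))

/-- The current `ψ ↦ l ((φ * ψ) x)`, for a functional `l` on covectors. -/
def smearedEvalCurrent (φ : TestFun d) (x : Eu d) (l : Covector d m →ₗ[ℝ] ℝ) : Current d m where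
  toFun ψ := l (convForm φ ψ x)
  map_add' ψ χ := by rw [map_add, add_apply, map_add]
  map_smul' c ψ := by rw [map_smul, smul_apply, map_smul, RingHom.id_apply]
  cont := by
    refine continuous_of_bound
      { toFun := fun ψ => l (convForm φ ψ x)
        map_add' := fun ψ χ => by rw [map_add, add_apply, map_add]
        map_smul' := fun c ψ => by rw [map_smul, smul_apply, map_smul, RingHom.id_apply] }
      (dualBound l * ∫ y, ‖φ y‖) fun ψ R hR => ?_
    rw [mul_assoc]
    exact abs_le_dualBound l (norm_convForm_le φ ψ R hR x)

theorem smearedEvalCurrent_apply (φ : TestFun d) (x : Eu d) (l : Covector d m →ₗ[ℝ] ℝ)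
    (ψ : TestForm d m) : smearedEvalCurrent φ x l ψ = l (convForm φ ψ x) := rfl

theorem spt_smearedEvalCurrent_subset (φ : TestFun d) (x : Eu d) (l : Covector d m →ₗ[ℝ] ℝ) :
    spt (smearedEvalCurrent φ x l) ⊆ {x} + tsupport (reflect φ) := by
  refine spt_subset_of_forall
    (isCompact_singleton.add (reflect φ).hasCompactSupport.isCompact).isClosed fun ψ hψ => ?_
  rw [smearedEvalCurrent_apply]
  by_cases hx : x ∈ tsupport (convForm φ ψ)
  · obtain ⟨a, ha, b, hb, rfl⟩ := tsupport_convForm_subset φ ψ hx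
    exact absurd ⟨a + b, rfl, -b, neg_mem_tsupport_reflect hb, by simp⟩ (disjoint_left.1 hψ ha)
  · rw [image_eq_zero_of_notMem_tsupport hx, map_zero]

/-- The normal current `ψ ↦ l ((φ * ψ) x)`. -/
def smearedEval (φ : TestFun d) (x : Eu d) : (Covector d m →ₗ[ℝ] ℝ) →ₗ[ℝ] NormalCurrents d m where
  toFun l := ⟨smearedEvalCurrent φ x l,
    (isCompact_singleton.add (reflect φ).hasCompactSupport.isCompact).of_isClosed_subset
      Distribution.isClosed_dsupport (spt_smearedEvalCurrent_subset φ x l), by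
    refine ne_top_of_le_ne_top ENNReal.ofReal_ne_top (normalMass_le_of_bound _
      (dualBound l * ∫ y, ‖φ y‖) (dualBound l * ((m + 1) * gradInt φ))
      (mul_nonneg (dualBound_nonneg l) (integral_nonneg fun _ => norm_nonneg _))
      (mul_nonneg (dualBound_nonneg l) (mul_nonneg (by positivity) (gradInt_nonneg φ)))
      (fun ψ hψ => ?_) (fun k e ψ hψ => ?_))
    · refine (le_abs_self _).trans (abs_le_dualBound l ?_)
      simpa using norm_convForm_le φ ψ 1 hψ x
    · subst e
      refine (le_abs_self _).trans (abs_le_dualBound l ?_)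
      rw [← extD_convForm]
      refine (norm_extD_convForm_le φ ψ 1 hψ x).trans ?_
      rw [mul_one]
      have := gradInt_nonneg φ
      gcongr
      simp⟩
  map_add' _ _ := rfl
  map_smul' _ _ := rfl

theorem spt_smearedEval_subset (φ : TestFun d) (x : Eu d) (l : Covector d m →ₗ[ℝ] ℝ) :
    spt (smearedEval φ x l : Current d m) ⊆ {x} + tsupport (reflect φ) :=
  spt_smearedEvalCurrent_subset φ x l

/-! ### Smoothness of the smeared evaluation of a charge -/

theorem spt_partialD_reflect_subset (φ : TestFun d) (i : Fin d) :
    tsupport (reflect (partialD i φ)) ⊆ -tsupport φ := by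
  refine closure_minimal (fun x hx => ?_) (isClosed_tsupport φ).neg
  have h1 : fderiv ℝ φ (-x) (EuclideanSpace.single i 1) ≠ 0 := by
    rw [← lineDerivOp_testFunction_apply]
    exact hx
  refine tsupport_fderiv_subset ℝ (subset_closure (Function.mem_support.2 fun h => h1 ?_))
  rw [h, zero_apply]

theorem spt_reflect_subset (φ : TestFun d) : tsupport (reflect φ) ⊆ -tsupport φ :=
  closure_minimal (fun _ hx => subset_tsupport _ hx) (isClosed_tsupport φ).neg

/-- The difference between the increment of the smeared evaluation and its linearization. -/
def smearedRem (φ : TestFun d) (x : Eu d) (l : Covector d m →ₗ[ℝ] ℝ) (h : Eu d) :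
    NormalCurrents d m :=
  smearedEval φ (x + h) l - smearedEval φ x l - ∑ i, h i • smearedEval (partialD i φ) x l

theorem smearedRem_apply (φ : TestFun d) (x : Eu d) (l : Covector d m →ₗ[ℝ] ℝ) (h : Eu d)
    (ψ : TestForm d m) : (smearedRem φ x l h : Current d m) ψ = l (convRem φ ψ x h) := by
  rw [convRem_eq_sum, smearedRem, map_sub, map_sub, map_sum, AddSubgroupClass.coe_sub,
    AddSubgroupClass.coe_sub, AddSubmonoidClass.coe_finsetSum, sub_apply, sub_apply, sum_apply]
  congr 1
  refine Finset.sum_congr rfl fun i _ => ?_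
  rw [map_smul]
  rfl

/-- Smallness holds in normal mass and not merely in flat norm. Hence the linear bound `|ω S| ≤ C
N(S)` gives a quadratic remainder for every `α`. -/
theorem realNormalMass_smearedRem_le (φ : TestFun d) (x : Eu d) (l : Covector d m →ₗ[ℝ] ℝ)
    (h : Eu d) : realNormalMass (smearedRem φ x l h) ≤
      dualBound l * (hessInt φ + (m + 1) * ∑ i, hessInt (partialD i φ)) * ‖h‖ ^ 2 := by
  have h0 := dualBound_nonneg l
  have h1 := hessInt_nonneg φ
  have h2 : 0 ≤ ∑ i, hessInt (partialD i φ) := Finset.sum_nonneg fun _ _ => hessInt_nonneg _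
  have h3 : 0 ≤ (m + 1) * ∑ i, hessInt (partialD i φ) := mul_nonneg (by positivity) h2
  refine realNormalMass_le _ _ (mul_nonneg (mul_nonneg h0 (add_nonneg h1 h3)) (sq_nonneg _)) ?_
  rw [mul_add, add_mul]
  refine normalMass_le_of_bound _ _ _ (mul_nonneg (mul_nonneg h0 h1) (sq_nonneg _))
    (mul_nonneg (mul_nonneg h0 h3) (sq_nonneg _)) (fun ψ hψ => ?_) (fun k e ψ hψ => ?_)
  · rw [smearedRem_apply, mul_assoc]
    refine (le_abs_self _).trans (abs_le_dualBound l ?_)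
    simpa using norm_convRem_le φ ψ 1 hψ x h
  · subst e
    rw [smearedRem_apply, mul_assoc]
    refine (le_abs_self _).trans (abs_le_dualBound l ?_)
    refine (norm_convRem_extD_le φ ψ 1 hψ x h).trans ?_
    rw [mul_one]
    exact mul_le_mul_of_nonneg_right (mul_le_mul_of_nonneg_right (by simp) h2) (sq_nonneg _)

theorem spt_sum_subset {ι : Type*} (s : Finset ι) (S : ι → NormalCurrents d m) {K : Set (Eu d)}
    (h : ∀ i ∈ s, spt (S i : Current d m) ⊆ K) :
    spt ((∑ i ∈ s, S i : NormalCurrents d m) : Current d m) ⊆ K := by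
  refine Finset.sum_induction _ (fun T : NormalCurrents d m => spt (T : Current d m) ⊆ K)
    (fun S T hS hT => (spt_add_subset _ _).trans (union_subset hS hT)) ?_ h
  change spt (0 : Current d m) ⊆ K
  rw [spt_zero]
  exact empty_subset _

theorem spt_smearedRem_subset (φ : TestFun d) (x : Eu d) (l : Covector d m →ₗ[ℝ] ℝ)
    (h : Eu d) (hh : ‖h‖ ≤ 1) : spt (smearedRem φ x l h : Current d m) ⊆
      Metric.closedBall x 1 + -tsupport φ := by
  have hx : {x} ⊆ Metric.closedBall x 1 := singleton_subset_iff.2 (by simp)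
  have hxh : {x + h} ⊆ Metric.closedBall x 1 := singleton_subset_iff.2 (by simpa using hh)
  refine spt_sub_subset (spt_sub_subset ?_ ?_) (spt_sum_subset _ _ fun i _ => ?_)
  · exact (spt_smearedEval_subset _ _ _).trans (add_subset_add hxh (spt_reflect_subset φ))
  · exact (spt_smearedEval_subset _ _ _).trans (add_subset_add hx (spt_reflect_subset φ))
  · exact (spt_smul_subset _ _).trans ((spt_smearedEval_subset _ _ _).trans
      (add_subset_add hx (spt_partialD_reflect_subset φ i)))

theorem IsFracCharge.hasFDerivAt_smearedEval {α : ℝ} (h0 : 0 < α) (h1 : α ≤ 1)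
    {ω : Functional d m} (hω : IsFracCharge α ω) (φ : TestFun d) (l : Covector d m →ₗ[ℝ] ℝ)
    (x : Eu d) : HasFDerivAt (fun y => ω (smearedEval φ y l))
      (∑ i, ω (smearedEval (partialD i φ) x l) • (EuclideanSpace.proj i : Eu d →L[ℝ] ℝ)) x := by
  -- One compact set carries the remainder currents for all increments of norm at most one, so `C`
  -- does not depend on `h`.
  obtain ⟨C, hC⟩ := hω.2 (Metric.closedBall x 1 + -tsupport φ)
    ((isCompact_closedBall x 1).add φ.hasCompactSupport.isCompact.neg)
  refine hasFDerivAt_of_quadratic_bound _ _ _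
    (C * (dualBound l * (hessInt φ + (m + 1) * ∑ i, hessInt (partialD i φ)))) ?_
  filter_upwards [Metric.closedBall_mem_nhds (0 : Eu d) one_pos] with h hh
  have hh' : ‖h‖ ≤ 1 := by simpa using hh
  have e : ω (smearedEval φ (x + h) l) - ω (smearedEval φ x l) -
      (∑ i, ω (smearedEval (partialD i φ) x l) • (EuclideanSpace.proj i : Eu d →L[ℝ] ℝ)) h =
      ω (smearedRem φ x l h) := by
    have e1 : ω (smearedRem φ x l h) = ω (smearedEval φ (x + h) l) - ω (smearedEval φ x l) -
        ω (∑ i, h i • smearedEval (partialD i φ) x l) :=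
      (map_sub ω _ _).trans (congrArg (· - _) (map_sub ω _ _))
    rw [e1, map_sum, sum_apply]
    congr 1
    refine Finset.sum_congr rfl fun i _ => ?_
    rw [map_smul, smul_eq_mul, mul_comm]
    rfl
  rw [e, mul_assoc]
  refine (hC.abs_le_realNormalMass h0 h1 _ (spt_smearedRem_subset φ x l h hh')).trans ?_
  gcongr
  exact realNormalMass_smearedRem_le φ x l h

theorem IsFracCharge.contDiff_smearedEval {α : ℝ} (h0 : 0 < α) (h1 : α ≤ 1)
    {ω : Functional d m} (hω : IsFracCharge α ω) (φ : TestFun d) (l : Covector d m →ₗ[ℝ] ℝ) :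
    ContDiff ℝ (⊤ : ℕ∞) (fun y => ω (smearedEval φ y l)) := by
  refine contDiff_infty.2 fun n => ?_
  -- The partial derivatives are functions of the same kind with `∂ᵢφ` as kernel, so the kernel must
  -- vary in the induction.
  induction n generalizing φ with
  | zero =>
    refine contDiff_zero.2 ?_
    exact continuous_iff_continuousAt.2 fun x =>
      (hω.hasFDerivAt_smearedEval h0 h1 φ l x).continuousAt
  | succ n ih =>
    refine contDiff_succ_iff_hasFDerivAt.2 ⟨_, ?_,
      fun x => hω.hasFDerivAt_smearedEval h0 h1 φ l x⟩
    exact ContDiff.sum fun i _ => (ih (partialD i φ)).smul contDiff_const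

/-! ### Discretization of a normal current -/

/-- A finite smooth partition of unity near a compact set, subordinate to balls of radius `δ`
with centers in the set. -/
structure FinePartition (K : Set (Eu d)) (δ : ℝ) (ι : Type) [Fintype ι] where
  /-- The centers of the balls. -/
  center : ι → Eu d
  /-- The functions of the partition. -/
  toFun : ι → TestFun d
  center_mem : ∀ i, center i ∈ K
  norm_sub_lt : ∀ i x, toFun i x ≠ 0 → ‖x - center i‖ < δ
  nonneg : ∀ i x, 0 ≤ toFun i x
  sum_le_one : ∀ x, ∑ i, toFun i x ≤ 1
  /-- The set on which the functions add up to one. -/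
  nbhd : Set (Eu d)
  isOpen_nbhd : IsOpen nbhd
  subset_nbhd : K ⊆ nbhd
  sum_eq_one : ∀ x ∈ nbhd, ∑ i, toFun i x = 1

theorem exists_finePartition {K : Set (Eu d)} (hK : IsCompact K) {δ : ℝ} (hδ : 0 < δ) :
    ∃ (ι : Type) (_ : Fintype ι), Nonempty (FinePartition K δ ι) := by
  obtain ⟨n, f, hfK, hf⟩ : ∃ (n : ℕ) (f : Fin n → Eu d), (∀ i, f i ∈ K) ∧
      K ⊆ ⋃ i, Metric.ball (f i) δ := by
    obtain ⟨t, htK, htf, ht⟩ := hK.finite_cover_balls hδ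
    have := htf.fintype
    let e := (Fintype.equivFin t).symm
    refine ⟨Fintype.card t, fun i => e i, fun i => htK (e i).2, fun x hx => ?_⟩
    obtain ⟨y, hy, hxy⟩ := mem_iUnion₂.1 (ht hx)
    exact mem_iUnion.2 ⟨e.symm ⟨y, hy⟩, by simpa using hxy⟩
  obtain ⟨r, hr, hrU⟩ := hK.exists_cthickening_subset_open
    (isOpen_iUnion fun i => Metric.isOpen_ball (x := f i) (ε := δ)) hf
  obtain ⟨ρ, hρ⟩ := SmoothPartitionOfUnity.exists_isSubordinate
    (modelWithCornersSelf ℝ (Eu d)) (Metric.isClosed_cthickening (δ := r) (E := K))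
    (fun i => Metric.ball (f i) δ) (fun i => Metric.isOpen_ball) hrU
  refine ⟨Fin n, inferInstance, ⟨
    { center := f
      toFun := fun i =>
        { toFun := ρ i
          contDiff' := (ρ i).contMDiff.contDiff
          hasCompactSupport' := (isCompact_closedBall (f i) δ).of_isClosed_subset
            (isClosed_tsupport _) ((hρ i).trans Metric.ball_subset_closedBall)
          tsupport_subset' := by simp }
      center_mem := hfK
      norm_sub_lt := fun i x hx => ?_
      nonneg := fun i x => ρ.nonneg i x
      sum_le_one := fun x => ?_
      nbhd := Metric.thickening r K
      isOpen_nbhd := Metric.isOpen_thickening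
      subset_nbhd := Metric.self_subset_thickening hr K
      sum_eq_one := fun x hx => ?_ }⟩⟩
  · have h1 : x ∈ Metric.ball (f i) δ := hρ i (subset_tsupport _ hx)
    rwa [Metric.mem_ball, dist_eq_norm] at h1
  · have := ρ.sum_le_one x
    rwa [finsum_eq_sum_of_fintype] at this
  · have := ρ.sum_eq_one (Metric.thickening_subset_cthickening r K hx)
    rwa [finsum_eq_sum_of_fintype] at this

/-- The product of a test function and a covector. -/
def constForm (ρ : TestFun d) : Covector d m →ₗ[ℝ] TestForm d m where
  toFun c :=
    { toFun := fun x => ρ x • c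
      contDiff' := ρ.contDiff.smul contDiff_const
      hasCompactSupport' := ρ.hasCompactSupport.smul_right
      tsupport_subset' := by simp }
  map_add' c c' := by
    ext1 x
    exact smul_add _ _ _
  map_smul' a c := by
    ext1 x
    exact smul_comm _ _ _

theorem FinePartition.norm_sum_le {K : Set (Eu d)} {δ : ℝ} {ι : Type} [Fintype ι]
    (P : FinePartition K δ ι) (x : Eu d) (a : ι → Covector d m) (B : ℝ) (hB : 0 ≤ B)
    (ha : ∀ i, P.toFun i x ≠ 0 → ‖a i‖ ≤ B) : ‖∑ i, P.toFun i x • a i‖ ≤ B := by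
  calc ‖∑ i, P.toFun i x • a i‖ ≤ ∑ i, P.toFun i x * B := by
        refine (_root_.norm_sum_le _ _).trans (Finset.sum_le_sum fun i _ => ?_)
        rw [norm_smul, Real.norm_of_nonneg (P.nonneg i x)]
        by_cases h : P.toFun i x = 0
        · simp [h]
        · exact mul_le_mul_of_nonneg_left (ha i h) (P.nonneg i x)
    _ = (∑ i, P.toFun i x) * B := (Finset.sum_mul _ _ _).symm
    _ ≤ B := mul_le_of_le_one_left hB (P.sum_le_one x)

theorem FinePartition.abs_sum_constForm_le {K : Set (Eu d)} {δ : ℝ} {ι : Type} [Fintype ι]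
    (P : FinePartition K δ ι) (T : Current d m) (hT : mass T ≠ ⊤) (c : ι → Covector d m) (B : ℝ)
    (hB : 0 ≤ B) (hc : ∀ i, ‖c i‖ ≤ B) :
    |∑ i, T (constForm (P.toFun i) (c i))| ≤ (mass T).toReal * B := by
  rw [← map_sum]
  refine abs_le_of_mass T hT _ B fun x => ?_
  have h1 : (∑ i, constForm (P.toFun i) (c i)) x = ∑ i, P.toFun i x • c i := sum_apply _ _ _
  rw [h1]
  exact P.norm_sum_le x c B hB fun i _ => hc i

/-- A Riemann sum estimate. The partition adds up to one on an open neighbourhood of the support, so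
`ψ` may be replaced by `∑ ρᵢ ψ`; equality on the support alone would not allow the vanishing
criterion to be used. The comass of `∑ ρᵢ (ψ - cᵢ)` is then at most `B`. -/
theorem FinePartition.abs_sub_sum_constForm_le {T : Current d m} {δ : ℝ} {ι : Type} [Fintype ι]
    (P : FinePartition (spt T) δ ι) (hT : mass T ≠ ⊤) (ψ : TestForm d m) (c : ι → Covector d m)
    (B : ℝ) (hB : 0 ≤ B) (hc : ∀ i x, ‖x - P.center i‖ < δ → ‖ψ x - c i‖ ≤ B) :
    |T ψ - ∑ i, T (constForm (P.toFun i) (c i))| ≤ (mass T).toReal * B := by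
  let χ : TestForm d m := ∑ i, mulForm (P.toFun i) (P.toFun i).contDiff ψ
  have hχ (x : Eu d) : χ x = ∑ i, P.toFun i x • ψ x := sum_apply _ _ _
  have h1 : T ψ = T χ := by
    rw [← sub_eq_zero, ← map_sub]
    refine eq_zero_of_disjoint_spt T _ (disjoint_left.2 fun x hx hxT => ?_)
    have hsub : tsupport (ψ - χ : TestForm d m) ⊆ P.nbhdᶜ := by
      refine closure_minimal (fun y hy hyU => hy ?_) P.isOpen_nbhd.isClosed_compl
      rw [sub_apply, hχ, ← Finset.sum_smul, P.sum_eq_one y hyU, one_smul, sub_self]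
    exact hsub hx (P.subset_nbhd hxT)
  rw [h1, ← map_sum, ← map_sub]
  refine abs_le_of_mass T hT _ B fun x => ?_
  have h2 : (∑ i, constForm (P.toFun i) (c i)) x = ∑ i, P.toFun i x • c i := sum_apply _ _ _
  have h3 : (χ - ∑ i, constForm (P.toFun i) (c i)) x = ∑ i, P.toFun i x • (ψ x - c i) := by
    rw [sub_apply, hχ, h2, ← Finset.sum_sub_distrib]
    refine Finset.sum_congr rfl fun i _ => ?_
    module
  rw [h3]
  exact P.norm_sum_le x _ B hB fun i hi => hc i x (P.norm_sub_lt i x hi)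

/-- The combination of smeared evaluations that approximates the convolution of a current. -/
def FinePartition.discretize {K : Set (Eu d)} {δ : ℝ} {ι : Type} [Fintype ι]
    (P : FinePartition K δ ι) (T : Current d m) (φ : TestFun d) : NormalCurrents d m :=
  ∑ i, smearedEval φ (P.center i)
    ((T : TestForm d m →ₗ[ℝ] ℝ).comp (constForm (P.toFun i)))

theorem FinePartition.discretize_apply {K : Set (Eu d)} {δ : ℝ} {ι : Type} [Fintype ι]
    (P : FinePartition K δ ι) (T : Current d m) (φ : TestFun d) (ψ : TestForm d m) :
    (P.discretize T φ : Current d m) ψ =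
      ∑ i, T (constForm (P.toFun i) (convForm φ ψ (P.center i))) := by
  rw [discretize, AddSubmonoidClass.coe_finsetSum, sum_apply]
  rfl

theorem FinePartition.spt_discretize_subset {K : Set (Eu d)} {δ : ℝ} {ι : Type} [Fintype ι]
    (P : FinePartition K δ ι) (T : Current d m) (φ : TestFun d) :
    spt (P.discretize T φ : Current d m) ⊆ K + tsupport (reflect φ) :=
  spt_sum_subset _ _ fun i _ => (spt_smearedEval_subset _ _ _).trans
    (add_subset_add_right (singleton_subset_iff.2 (P.center_mem i)))

theorem FinePartition.abs_mollify_sub_discretize_le {T : NormalCurrents d m} {δ : ℝ} {ι : Type}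
    [Fintype ι] (hδ : 0 < δ) (P : FinePartition (spt (T : Current d m)) δ ι) (φ : TestFun d)
    (ψ : TestForm d m) (hψ : ∀ x, ‖ψ x‖ ≤ 1) :
    |((mollify T φ - P.discretize T φ : NormalCurrents d m) : Current d m) ψ| ≤
      (mass (T : Current d m)).toReal * (gradInt φ * δ) := by
  rw [AddSubgroupClass.coe_sub, sub_apply, mollify_apply, P.discretize_apply]
  refine P.abs_sub_sum_constForm_le (mass_ne_top T.2) _ _ _
    (mul_nonneg (gradInt_nonneg φ) hδ.le) fun i x hx => ?_
  refine (norm_convForm_sub_le φ ψ 1 hψ x (P.center i)).trans ?_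
  rw [mul_one]
  exact mul_le_mul_of_nonneg_left hx.le (gradInt_nonneg φ)

theorem FinePartition.realFlatNorm_mollify_sub_discretize_le {T : NormalCurrents d m} {δ : ℝ}
    {ι : Type} [Fintype ι] (hδ : 0 < δ) (P : FinePartition (spt (T : Current d m)) δ ι)
    (φ : TestFun d) : realFlatNorm (mollify T φ - P.discretize T φ) ≤
      (mass (T : Current d m)).toReal * (gradInt φ * δ) :=
  realFlatNorm_le _ _ (mul_nonneg ENNReal.toReal_nonneg (mul_nonneg (gradInt_nonneg φ) hδ.le))
    fun ψ hψ _ => (le_abs_self _).trans (P.abs_mollify_sub_discretize_le hδ φ ψ hψ)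

/-- A bound independent of `δ` is enough, since the flat norm tends to zero and enters with the
positive exponent `α`. On the boundary the two currents are therefore estimated separately. -/
theorem FinePartition.realNormalMass_mollify_sub_discretize_le {T : NormalCurrents d m} {δ : ℝ}
    {ι : Type} [Fintype ι] (hδ : 0 < δ) (hδ1 : δ ≤ 1)
    (P : FinePartition (spt (T : Current d m)) δ ι) (φ : TestFun d) :
    realNormalMass (mollify T φ - P.discretize T φ) ≤
      (mass (T : Current d m)).toReal * gradInt φ +
        2 * ((mass (T : Current d m)).toReal * ((m + 1) * gradInt φ)) := by
  have hM : 0 ≤ (mass (T : Current d m)).toReal := ENNReal.toReal_nonneg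
  have hg := gradInt_nonneg φ
  refine realNormalMass_le _ _ (by positivity) (normalMass_le_of_bound _ _ _ (by positivity)
    (by positivity) (fun ψ hψ => ?_) (fun k e ψ hψ => ?_))
  · refine (le_abs_self _).trans ((P.abs_mollify_sub_discretize_le hδ φ ψ hψ).trans ?_)
    gcongr
    exact mul_le_of_le_one_right hg hδ1
  · subst e
    have h1 (x : Eu d) : ‖convForm φ (extD ψ) x‖ ≤ ((k + 1 : ℕ) + 1) * gradInt φ := by
      rw [← extD_convForm]
      refine (norm_extD_convForm_le φ ψ 1 hψ x).trans ?_
      rw [mul_one]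
      exact mul_le_mul_of_nonneg_right (by simp) hg
    have h2 := abs_le_of_mass _ (mass_ne_top T.2) _ _ h1
    have h3 := P.abs_sum_constForm_le _ (mass_ne_top T.2)
      (fun i => convForm φ (extD ψ) (P.center i)) _ ((norm_nonneg _).trans (h1 0)) fun i => h1 _
    simp only [AddSubgroupClass.coe_sub, sub_apply, mollify_apply, P.discretize_apply]
    refine (le_abs_self _).trans ((abs_sub _ _).trans ?_)
    rw [two_mul]
    exact add_le_add h2 h3

/-! ### The form that represents the convolution of a charge -/

/-- The density of the convolution of a charge and a test function. -/
def chargeDensity (ω : Functional d m) (φ : TestFun d) (x : Eu d) : Covector d m :=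
  ∑ j, ω (smearedEval φ x ((Module.finBasis ℝ (Covector d m)).coord j)) •
    Module.finBasis ℝ (Covector d m) j

theorem apply_chargeDensity (ω : Functional d m) (φ : TestFun d) (x : Eu d)
    (l : Covector d m →ₗ[ℝ] ℝ) : l (chargeDensity ω φ x) = ω (smearedEval φ x l) := by
  let b := Module.finBasis ℝ (Covector d m)
  have hl : l = ∑ j, l (b j) • b.coord j := by
    refine b.ext fun i => ?_
    rw [LinearMap.sum_apply]
    simp [Finsupp.single_apply]
  conv_rhs => rw [hl]
  rw [chargeDensity, map_sum, map_sum, map_sum]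
  refine Finset.sum_congr rfl fun j _ => ?_
  rw [map_smul, map_smul, map_smul, smul_eq_mul, smul_eq_mul, mul_comm]

theorem IsFracCharge.contDiff_chargeDensity {α : ℝ} (h0 : 0 < α) (h1 : α ≤ 1)
    {ω : Functional d m} (hω : IsFracCharge α ω) (φ : TestFun d) :
    ContDiff ℝ (⊤ : ℕ∞) (chargeDensity ω φ) :=
  ContDiff.sum fun _ _ => (hω.contDiff_smearedEval h0 h1 φ _).smul contDiff_const

/-- The functional attached to the `i`-th centre is `c ↦ T (ρᵢ c)`, so the defining property of the
density turns `ω` of the discretization into a Riemann sum for `T` applied to the density. -/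
theorem FinePartition.apply_discretize {K : Set (Eu d)} {δ : ℝ} {ι : Type} [Fintype ι]
    (P : FinePartition K δ ι) (ω : Functional d m) (T : Current d m) (φ : TestFun d) :
    ω (P.discretize T φ) =
      ∑ i, T (constForm (P.toFun i) (chargeDensity ω φ (P.center i))) := by
  rw [discretize, map_sum]
  refine Finset.sum_congr rfl fun i _ => ?_
  rw [← apply_chargeDensity]
  rfl

theorem IsFracCharge.isGivenBy_chargeDensity {α : ℝ} (h0 : 0 < α) (h1 : α ≤ 1)
    {ω : Functional d m} (hω : IsFracCharge α ω) (φ : TestFun d) :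
    IsGivenBy (FracCharge.chargeConv ω φ) (chargeDensity ω φ) := by
  intro T ψ hψ
  obtain ⟨C, hC⟩ := hω.2 _ (T.2.1.add (reflect φ).hasCompactSupport.isCompact)
  obtain ⟨L, hL⟩ := (ψ.contDiff.of_le (by exact_mod_cast le_top) :
    ContDiff ℝ 1 ψ).lipschitzWith_of_hasCompactSupport ψ.hasCompactSupport one_ne_zero
  obtain ⟨M, hM⟩ : ∃ M, (mass (T : Current d m)).toReal = M := ⟨_, rfl⟩
  obtain ⟨A, hA⟩ : ∃ A, M * gradInt φ + 2 * (M * ((m + 1) * gradInt φ)) = A := ⟨_, rfl⟩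
  -- The discretization at mesh `δ` lies between the two sides: it is close to `T_φ` by the
  -- fractional bound, and its value under `ω` is close to `T ψ` as a Riemann sum.
  have key (δ : ℝ) (hδ : δ ∈ Ioc (0 : ℝ) 1) : |ω (mollify T φ) - (T : Current d m) ψ| ≤
      C * A ^ (1 - α) * (M * (gradInt φ * δ)) ^ α + M * (L * δ) := by
    obtain ⟨ι, _, ⟨P⟩⟩ := exists_finePartition T.2.1 hδ.1
    have hN := P.realNormalMass_mollify_sub_discretize_le hδ.1 hδ.2 φ
    have hF := P.realFlatNorm_mollify_sub_discretize_le hδ.1 φ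
    have hs : spt ((mollify T φ - P.discretize T φ : NormalCurrents d m) : Current d m) ⊆
        spt (T : Current d m) + tsupport (reflect φ) :=
      spt_sub_subset (spt_mollify_subset T φ) (P.spt_discretize_subset _ φ)
    rw [hM, hA] at hN
    rw [hM] at hF
    have e1 := hC.abs_le h0 h1 _ hs A _ hN hF
    have e2 : ω (mollify T φ - P.discretize T φ) = ω (mollify T φ) - ω (P.discretize T φ) :=
      map_sub ω _ _
    have e3 := P.abs_sub_sum_constForm_le (mass_ne_top T.2) ψ
      (fun i => chargeDensity ω φ (P.center i)) (L * δ) (mul_nonneg L.2 hδ.1.le)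
      fun i x hx => by
        -- The centres lie in the support of `T`, where `ψ` and the density agree; the comparison is
        -- then between two values of `ψ`.
        rw [← hψ.self_of_nhdsSet _ (P.center_mem i), ← dist_eq_norm]
        refine (hL.dist_le_mul _ _).trans (mul_le_mul_of_nonneg_left ?_ L.2)
        rw [dist_eq_norm]
        exact hx.le
    rw [e2, P.apply_discretize] at e1
    rw [abs_sub_comm, hM] at e3
    exact (abs_sub_le _ _ _).trans (add_le_add e1 e3)
  have hlim : Tendsto (fun δ : ℝ => C * A ^ (1 - α) * (M * (gradInt φ * δ)) ^ α + M * (L * δ))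
      (𝓝[>] 0) (𝓝 (C * A ^ (1 - α) * (M * (gradInt φ * 0)) ^ α + M * (L * 0))) := by
    refine (Continuous.tendsto ?_ _).mono_left nhdsWithin_le_nhds
    have : Continuous fun δ : ℝ => (M * (gradInt φ * δ)) ^ α :=
      Continuous.rpow_const (by fun_prop) fun _ => Or.inr h0.le
    fun_prop
  rw [mul_zero, mul_zero, Real.zero_rpow h0.ne', mul_zero, mul_zero, mul_zero, add_zero] at hlim
  have h := ge_of_tendsto hlim (by
    filter_upwards [Ioc_mem_nhdsGT one_pos] with δ hδ using key δ hδ)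
  rw [chargeConv_apply]
  exact sub_eq_zero.1 (abs_nonpos_iff.1 h)

end FracCharge

end

theorem proposition4p6 (d m : ℕ) (Φ : TestFun d) (hΦ : IsMollifier Φ) :
    ∃ C : ℝ≥0, ∀ α : ℝ, 0 < α → α ≤ 1 → ∀ ω : Functional d m, IsFracCharge α ω →
      (∀ (ε : ℝ) (hε : 0 < ε), ε ≤ 1 →
        (∃ η : Eu d → Covector d m, ContDiff ℝ (⊤ : ℕ∞) η ∧
          IsGivenBy (chargeConv ω (rescale Φ ε hε)) η) ∧
        ∀ K : Set (Eu d), IsCompact K →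
          fracNorm α K (chargeConv ω (rescale Φ ε hε))
              ≤ fracNorm α (Metric.cthickening ε K) ω ∧
          fracNorm 1 K (chargeConv ω (rescale Φ ε hε))
              ≤ C * ENNReal.ofReal (ε ^ (α - 1)) * fracNorm α (Metric.cthickening ε K) ω ∧
          chargeNorm K (ω - chargeConv ω (rescale Φ ε hε))
              ≤ C * ENNReal.ofReal (ε ^ α) * fracNorm α (Metric.cthickening ε K) ω) ∧
      ∀ (ε : ℕ → ℝ) (hε : ∀ n, 0 < ε n), (∀ n, ε n ≤ 1) → Tendsto ε atTop (𝓝 0) →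
        WeakStarTendsto α (fun n => chargeConv ω (rescale Φ (ε n) (hε n))) ω := by
  refine ⟨mollifyConst m Φ, fun α h0 h1 ω hω => ⟨fun ε hε hε1 => ⟨⟨chargeDensity ω _,
    hω.contDiff_chargeDensity h0 h1 _, hω.isGivenBy_chargeDensity h0 h1 _⟩, fun K _ =>
    ⟨fracNorm_chargeConv_le hΦ hε h0 h1 K ω, fracNorm_one_chargeConv_le hΦ hε hε1 h0 h1 K ω,
      chargeNorm_sub_chargeConv_le hΦ hε h0 h1 K ω⟩⟩, fun ε hε hε1 hlim =>
    hω.weakStarTendsto_chargeConv hΦ h0 h1 ε hε hε1 hlim⟩⟩
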